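/- Let $n\ge 0$ and let $Y$ be a compact smooth $n$-dimensional Riemannian manifold without boundary, with Riemannian volume measure $\mathrm{vol}$ (given by $\sqrt{\det(g_{ij})}\,du$ in local coordinates). Let $d$ be the Riemannian distance on $Y$; if $Y$ is not connected, let $d$ be any (finite) metric on $Y$ which induces the topology of $Y$ and restricts to the Riemannian distance on each connected component. (1) There are constants $c,C>0$ such that for every $p\in[1,\infty)$ and every $x\in Y$ the function $d(x,\cdot)$ belongs to $L^p(Y,\mathrm{vol})$, and the metric $d'_p(x,y)=\|d(x,\cdot)-d(y,\cdot)\|_{L^p(Y,\mathrm{vol})}$, induced by the Kuratowski-type embedding $Y\to L^p(Y,\mathrm{vol})$, $x\mapsto d(x,\cdot)$, satisfies $$c\,d(x,y)\le d'_p(x,y)\le C\,d(x,y)\qquad\text{for all } x,y\in Y .$$ The constants $c$ and $C$ do not depend on $p$. An action of a group $\Gamma$ on a metric space $Y$ is called linearisable in a Banach space $E$ if there exist a representation of $\Gamma$ on $E$ by linear isometries and a $\Gamma$-equivariant bi-Lipschitz embedding $Y\to E$. (2) For every $p\in[1,\infty)$, every action of a group $\Gamma$ on $(Y,d)$ by isometries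 is linearisable in $L^p(Y,\mathrm{vol})$. (3) In particular, if $Y$ is moreover a (compact) Lie group and $d$ is invariant under left translations, then for every subgroup $\Gamma\le Y$ and every $p\in[1,\infty)$ the action of $\Gamma$ on $Y$ by left translations is linearisable in $L^p(Y,\mathrm{vol})$. -/

import Mathlib

open MeasureTheory Bundle Manifold
open scoped Manifold ContDiff

noncomputable section

/-- The metric `d` of `Y` restricts to the Riemannian distance (the infimum of the lengths of `C^1`
paths) on each connected component. If `Y` is connected, this says that `d` is the Riemannian
distance; if not, `d` is a finite metric, defining the topology of the manifold `Y`, whose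
restriction to each component is the Riemannian distance. -/
def IsRiemannianOnComponents (n : ℕ) (Y : Type*) [MetricSpace Y]
    [ChartedSpace (EuclideanSpace ℝ (Fin n)) Y]
    [RiemannianBundle (fun y : Y ↦ TangentSpace (𝓡 n) y)] : Prop :=
  ∀ x y : Y, y ∈ connectedComponent x → edist x y = riemannianEDist (𝓡 n) x y

/-- The Riemannian volume density `√(det (gᵢⱼ))` in the coordinates of the preferred chart at `x`,
at the point of coordinates `u`: here `gᵢⱼ = ⟪∂ᵢ, ∂ⱼ⟫`, where the coordinate vector field `∂ᵢ` is
the image of the `i`-th standard basis vector under the differential of the inverse chart. -/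
def riemannianDensity {n : ℕ} {Y : Type*} [MetricSpace Y]
    [ChartedSpace (EuclideanSpace ℝ (Fin n)) Y]
    [RiemannianBundle (fun y : Y ↦ TangentSpace (𝓡 n) y)]
    (x : Y) (u : EuclideanSpace ℝ (Fin n)) : ℝ :=
  letI e := chartAt (EuclideanSpace ℝ (Fin n)) x
  letI coordVec : Fin n → TangentSpace (𝓡 n) (e.symm u) := fun i ↦
    mfderiv (𝓡 n) (𝓡 n) e.symm u (EuclideanSpace.single i (1 : ℝ) : EuclideanSpace ℝ (Fin n))
  Real.sqrt (Matrix.det (Matrix.of fun i j ↦ inner ℝ (coordVec i) (coordVec j)))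

/-- The Riemannian volume on the domain of the preferred chart at `x` (and zero outside):
`A ↦ ∫_{e(A ∩ dom e)} √(det g) du`. -/
def riemannianVolumeInChart {n : ℕ} {Y : Type*} [MetricSpace Y] [MeasurableSpace Y]
    [ChartedSpace (EuclideanSpace ℝ (Fin n)) Y]
    [RiemannianBundle (fun y : Y ↦ TangentSpace (𝓡 n) y)] (x : Y) : Measure Y :=
  letI e := chartAt (EuclideanSpace ℝ (Fin n)) x
  ((volume.restrict e.target).withDensity fun u ↦
    ENNReal.ofReal (riemannianDensity x u)).map e.symm

/-- The Riemannian volume measure. By the change of variables formula the measures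
`riemannianVolumeInChart x` agree on the overlaps of the chart domains, so (on a manifold which is
a countable union of chart domains) their supremum is the unique Borel measure which restricts to
`riemannianVolumeInChart x` on the domain of the chart at `x`, for every `x`. -/
def riemannianVolume (n : ℕ) (Y : Type*) [MetricSpace Y] [MeasurableSpace Y]
    [ChartedSpace (EuclideanSpace ℝ (Fin n)) Y]
    [RiemannianBundle (fun y : Y ↦ TangentSpace (𝓡 n) y)] : Measure Y :=
  ⨆ x : Y, riemannianVolumeInChart (n := n) x

/-- The Kuratowski embedding `x ↦ d(x, ·)` into `L^p(Y, μ)`. -/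
def lpKuratowskiEmbedding {Y : Type*} [MetricSpace Y] [MeasurableSpace Y] (p : ENNReal)
    (μ : Measure Y) (h : ∀ x : Y, MemLp (fun z ↦ dist x z) p μ) : Y → Lp ℝ p μ :=
  fun x ↦ (h x).toLp (fun z ↦ dist x z)

/-- An action of `Γ` on a metric space `Y` is linearisable in the Banach space `E` if there are an
isometric linear representation of `Γ` on `E` and an equivariant bi-Lipschitz embedding `Y → E`. -/
def IsLinearisable (Γ Y E : Type*) [Group Γ] [MetricSpace Y] [MulAction Γ Y]
    [NormedAddCommGroup E] [NormedSpace ℝ E] : Prop :=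
  ∃ (ρ : Γ →* (E ≃ₗᵢ[ℝ] E)) (f : Y → E),
    (∀ (γ : Γ) (y : Y), f (γ • y) = ρ γ (f y)) ∧
    ∃ K K' : NNReal, LipschitzWith K f ∧ AntilipschitzWith K' f

end

/-! Upper bound: `|d(x,z) - d(y,z)| ≤ d(x,y)` and the volume is finite. For the lower bound, Hölder
reduces every `p` to `L^1`, and both constants involve `p` only through powers of the total mass
with exponent in `[0,1]`, hence are uniform. By compactness of `Y × Y` the `L^1` bound is a local
question. Near a pair of distinct points, a small ball around the first one is enough.

Near the diagonal one needs, for close points `u ≠ v`, a ball of definite size on which `d(u,z) -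
d(v,z)` is at least a fixed multiple of `d(u,v)` (`exists_ball_mul_dist_le_dist_sub_dist`). Neither
geodesics nor a first variation formula enters. In a chart, an affine map fixing `z` and sending `u`
to `v` is a contraction of ratio about `1 - s`, with `s` proportional to `|u - v|`. It moves points
by `O(s)`, so in a small chart the variation of the metric costs only a fraction of `s`, and curves
from `u` to `z` become curves from `v` to `z` shorter by a factor `1 - s/3`. As `d(u,z)` is bounded
below, the gain is comparable to `d(u,v)`.

For the actions, an isometry must preserve the volume. Near each point `d` is `(1+ε)`-bi-Lipschitz
to the Euclidean distance given by the metric at that point, so the volume is a constant multiple of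
the `n`-dimensional Hausdorff measure (`riemannianVolume_eq_hausdorffMeasure`), which depends on `d`
alone. Then `F ↦ F ∘ γ⁻¹` is an isometric representation on `L^p`, for which the Kuratowski
embedding is equivariant. -/

noncomputable section

open Set Filter Topology
open scoped NNReal ENNReal

/-! ### The Riemannian metric in a chart -/

section ChartMetric

variable {n : ℕ} {Y : Type*} [MetricSpace Y]
    [ChartedSpace (EuclideanSpace ℝ (Fin n)) Y]

/-- The coordinate vector field `∂ᵢ` of the preferred chart at `x`. -/
def chartVec (x : Y) (u : EuclideanSpace ℝ (Fin n)) (i : Fin n) :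
    TangentSpace (𝓡 n) ((chartAt (EuclideanSpace ℝ (Fin n)) x).symm u) :=
  mfderiv (𝓡 n) (𝓡 n) (chartAt (EuclideanSpace ℝ (Fin n)) x).symm u
    (EuclideanSpace.single i (1 : ℝ) : EuclideanSpace ℝ (Fin n))

lemma mfderiv_chart_symm_eq_sum (x : Y) (u v : EuclideanSpace ℝ (Fin n)) :
    mfderiv (𝓡 n) (𝓡 n) (chartAt (EuclideanSpace ℝ (Fin n)) x).symm u v
      = ∑ i, v i • chartVec x u i := by
  have hv : v = ∑ i, v i • (EuclideanSpace.single i (1 : ℝ) : EuclideanSpace ℝ (Fin n)) := by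
    ext j; simp [Finset.sum_apply, Pi.single_apply]
  conv_lhs => rw [hv]
  exact (map_sum (mfderiv (𝓡 n) (𝓡 n) (chartAt (EuclideanSpace ℝ (Fin n)) x).symm u) _ _).trans
    (Finset.sum_congr rfl fun i _ ↦ map_smul _ _ _)

variable [RiemannianBundle (fun y : Y ↦ TangentSpace (𝓡 n) y)]

/-- The Riemannian norm of the vector `v` at the point `u`, in the coordinates of the preferred
chart at `x`. -/
def chartNorm (x : Y) (u v : EuclideanSpace ℝ (Fin n)) : ℝ :=
  ‖mfderiv (𝓡 n) (𝓡 n) (chartAt (EuclideanSpace ℝ (Fin n)) x).symm u v‖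

/-- The matrix of the Riemannian metric in the coordinates of the preferred chart at `x`. -/
def chartGram (x : Y) (u : EuclideanSpace ℝ (Fin n)) : Matrix (Fin n) (Fin n) ℝ :=
  Matrix.of fun i j ↦ inner ℝ (chartVec x u i) (chartVec x u j)

lemma riemannianDensity_eq_sqrt_det_chartGram (x : Y) (u : EuclideanSpace ℝ (Fin n)) :
    riemannianDensity x u = Real.sqrt (chartGram x u).det := rfl

lemma chartNorm_sq (x : Y) (u v : EuclideanSpace ℝ (Fin n)) :
    chartNorm x u v ^ 2 = ∑ i, ∑ j, v i * v j * chartGram x u i j := by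
  rw [chartNorm, mfderiv_chart_symm_eq_sum, ← real_inner_self_eq_norm_sq, sum_inner]
  simp_rw [inner_sum, real_inner_smul_left, real_inner_smul_right, chartGram, Matrix.of_apply]
  simp [mul_assoc]

lemma chartNorm_nonneg (x : Y) (u v : EuclideanSpace ℝ (Fin n)) : 0 ≤ chartNorm x u v :=
  norm_nonneg _

lemma chartNorm_add_le (x : Y) (u v w : EuclideanSpace ℝ (Fin n)) :
    chartNorm x u (v + w) ≤ chartNorm x u v + chartNorm x u w := by
  have : mfderiv (𝓡 n) (𝓡 n) (chartAt (EuclideanSpace ℝ (Fin n)) x).symm u (v + w)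
    = mfderiv (𝓡 n) (𝓡 n) (chartAt (EuclideanSpace ℝ (Fin n)) x).symm u v
      + mfderiv (𝓡 n) (𝓡 n) (chartAt (EuclideanSpace ℝ (Fin n)) x).symm u w := map_add _ _ _
  rw [chartNorm, this]
  exact norm_add_le _ _

lemma chartNorm_smul (x : Y) (u v : EuclideanSpace ℝ (Fin n)) (c : ℝ) :
    chartNorm x u (c • v) = |c| * chartNorm x u v := by
  have : mfderiv (𝓡 n) (𝓡 n) (chartAt (EuclideanSpace ℝ (Fin n)) x).symm u (c • v)
    = c • mfderiv (𝓡 n) (𝓡 n) (chartAt (EuclideanSpace ℝ (Fin n)) x).symm u v := map_smul _ _ _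
  rw [chartNorm, this, norm_smul, Real.norm_eq_abs, chartNorm]

variable [IsManifold (𝓡 n) ∞ Y]

/-- A Euclidean linear model of the Riemannian metric at a point. -/
lemma exists_linearMap_norm_eq_chartNorm (x : Y) {u : EuclideanSpace ℝ (Fin n)}
    (hu : u ∈ (chartAt (EuclideanSpace ℝ (Fin n)) x).target) :
    ∃ T : EuclideanSpace ℝ (Fin n) ≃L[ℝ] EuclideanSpace ℝ (Fin n),
      (∀ v, ‖T v‖ = chartNorm x u v) ∧
      |LinearMap.det (T : EuclideanSpace ℝ (Fin n) →ₗ[ℝ] EuclideanSpace ℝ (Fin n))|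
        = riemannianDensity x u := by
  set e := chartAt (EuclideanSpace ℝ (Fin n)) x with he
  have hinv : e.MDifferentiable (𝓡 n) (𝓡 n) := mdifferentiable_chart (I := 𝓡 n) x
  have hbij := hinv.symm.mfderiv_bijective (x := u) hu
  let D : EuclideanSpace ℝ (Fin n) ≃ₗ[ℝ] TangentSpace (𝓡 n) (e.symm u) :=
    LinearEquiv.ofBijective (mfderiv (𝓡 n) (𝓡 n) e.symm u).toLinearMap hbij
  have : FiniteDimensional ℝ (TangentSpace (𝓡 n) (e.symm u)) := D.finiteDimensional
  have hrank : Module.finrank ℝ (TangentSpace (𝓡 n) (e.symm u)) = n := by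
    rw [← D.finrank_eq]; simp
  let b := (stdOrthonormalBasis ℝ (TangentSpace (𝓡 n) (e.symm u))).reindex (finCongr hrank)
  let T := (D.trans b.repr.toLinearEquiv).toContinuousLinearEquiv
  have hT : ∀ v, T v = b.repr (D v) := fun v ↦ rfl
  refine ⟨T, fun v ↦ ?_, ?_⟩
  · rw [hT, b.repr.norm_map]; rfl
  · rw [riemannianDensity_eq_sqrt_det_chartGram, ← Real.sqrt_sq_eq_abs]
    congr 1
    let B := (EuclideanSpace.basisFun (Fin n) ℝ).toBasis
    let T' : EuclideanSpace ℝ (Fin n) →ₗ[ℝ] EuclideanSpace ℝ (Fin n) := T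
    change LinearMap.det T' ^ 2 = _
    have : chartGram x u = (LinearMap.toMatrix B B T').transpose * LinearMap.toMatrix B B T' := by
      ext i j
      have h1 : chartGram x u i j
        = inner ℝ (T' (EuclideanSpace.single i 1)) (T' (EuclideanSpace.single j 1)) := by
        change _ = inner ℝ (b.repr (D (EuclideanSpace.single i 1)))
          (b.repr (D (EuclideanSpace.single j 1)))
        rw [b.repr.inner_map_map]; rfl
      rw [h1, Matrix.mul_apply]
      simp [B, LinearMap.toMatrix_apply, PiLp.inner_apply, mul_comm]
    rw [this, Matrix.det_mul, Matrix.det_transpose, LinearMap.det_toMatrix, sq]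

variable [IsContMDiffRiemannianBundle (𝓡 n) ∞ (EuclideanSpace ℝ (Fin n))
      (fun y : Y ↦ TangentSpace (𝓡 n) y)]

/-- Each coordinate field is the tangent map of the inverse chart applied to a constant field, and
the metric is smooth. Class `C^1` suffices: only a local Lipschitz bound is used later. -/
lemma contDiffOn_chartGram (x : Y) (i j : Fin n) :
    ContDiffOn ℝ 1 (fun u ↦ chartGram x u i j) (chartAt (EuclideanSpace ℝ (Fin n)) x).target := by
  set e := chartAt (EuclideanSpace ℝ (Fin n)) x with he
  have key : ∀ k : Fin n, ContMDiffOn (𝓡 n) ((𝓡 n).prod 𝓘(ℝ, EuclideanSpace ℝ (Fin n))) 1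
      (fun u ↦ (⟨e.symm u, chartVec x u k⟩ : TangentBundle (𝓡 n) Y)) e.target := by
    intro k
    have h1 : ContMDiffOn (𝓡 n) (𝓡 n) 2 e.symm e.target := contMDiffOn_chart_symm
    have h2 := h1.contMDiffOn_tangentMapWithin (m := 1) (by norm_num)
      e.open_target.uniqueMDiffOn
    have h3 : ContMDiffOn (𝓡 n) ((𝓡 n).prod 𝓘(ℝ, EuclideanSpace ℝ (Fin n))) 1
      (fun u ↦ (⟨u, (EuclideanSpace.single k (1 : ℝ) : EuclideanSpace ℝ (Fin n))⟩ :
        TangentBundle (𝓡 n) (EuclideanSpace ℝ (Fin n)))) e.target := by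
      apply contMDiffOn_vectorSpace_iff_contDiffOn.2
      exact contDiffOn_const
    refine (h2.comp h3 (fun u hu ↦ hu)).congr fun u hu ↦ ?_
    simp only [Function.comp_apply, tangentMapWithin]
    rw [mfderivWithin_of_mem_nhds (e.open_target.mem_nhds hu)]
    rfl
  have : IsContMDiffRiemannianBundle (𝓡 n) 1 (EuclideanSpace ℝ (Fin n))
      (fun y : Y ↦ TangentSpace (𝓡 n) y) :=
    IsContMDiffRiemannianBundle.of_le (n := ∞) (by norm_cast)
  exact contMDiffOn_iff_contDiffOn.1 (ContMDiffOn.inner_bundle (key i) (key j))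

end ChartMetric

section ChartControl

variable {n : ℕ} {Y : Type*} [MetricSpace Y]
    [ChartedSpace (EuclideanSpace ℝ (Fin n)) Y]
    [RiemannianBundle (fun y : Y ↦ TangentSpace (𝓡 n) y)] [IsManifold (𝓡 n) ∞ Y]
    [IsContMDiffRiemannianBundle (𝓡 n) ∞ (EuclideanSpace ℝ (Fin n))
      (fun y : Y ↦ TangentSpace (𝓡 n) y)]

/-- The squared norm is linear in the Gram matrix, whose entries are locally Lipschitz; summing over
the `n²` entries gives `L`. -/
lemma exists_abs_chartNorm_sq_sub_le (x : Y) {u₀ : EuclideanSpace ℝ (Fin n)}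
    (hu₀ : u₀ ∈ (chartAt (EuclideanSpace ℝ (Fin n)) x).target) :
    ∃ r > 0, ∃ L ≥ 0, Metric.ball u₀ r ⊆ (chartAt (EuclideanSpace ℝ (Fin n)) x).target ∧
      ∀ u ∈ Metric.ball u₀ r, ∀ u' ∈ Metric.ball u₀ r, ∀ v,
        |chartNorm x u' v ^ 2 - chartNorm x u v ^ 2| ≤ L * ‖u' - u‖ * ‖v‖ ^ 2 := by
  set e := chartAt (EuclideanSpace ℝ (Fin n)) x with he
  have hC : ContDiffAt ℝ 1 (fun u ↦ fun i j ↦ chartGram x u i j) u₀ := by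
    refine contDiffAt_pi.2 fun i ↦ contDiffAt_pi.2 fun j ↦ ?_
    exact (contDiffOn_chartGram x i j).contDiffAt (e.open_target.mem_nhds hu₀)
  obtain ⟨K, t, ht, hK⟩ := hC.exists_lipschitzOnWith
  obtain ⟨r, hr, hball⟩ := Metric.mem_nhds_iff.1 (inter_mem ht (e.open_target.mem_nhds hu₀))
  refine ⟨r, hr, ∑ i : Fin n, ∑ j : Fin n, (K : ℝ), by positivity,
    fun u hu ↦ (hball hu).2, fun u hu u' hu' v ↦ ?_⟩
  have hG : ∀ i j, |chartGram x u' i j - chartGram x u i j| ≤ K * ‖u' - u‖ := by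
    intro i j
    have h1 := hK.dist_le_mul u' (hball hu').1 u (hball hu).1
    rw [← dist_eq_norm u' u]
    refine le_trans ?_ h1
    rw [← Real.dist_eq]
    exact (dist_le_pi_dist (chartGram x u' i) (chartGram x u i) j).trans
      (dist_le_pi_dist (fun i j ↦ chartGram x u' i j) (fun i j ↦ chartGram x u i j) i)
  rw [chartNorm_sq, chartNorm_sq, ← Finset.sum_sub_distrib, Finset.sum_mul, Finset.sum_mul]
  refine (Finset.abs_sum_le_sum_abs _ _).trans (Finset.sum_le_sum fun i _ ↦ ?_)
  rw [← Finset.sum_sub_distrib, Finset.sum_mul, Finset.sum_mul]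
  refine (Finset.abs_sum_le_sum_abs _ _).trans (Finset.sum_le_sum fun j _ ↦ ?_)
  rw [← mul_sub, abs_mul, abs_mul]
  have hi : |v i| ≤ ‖v‖ := PiLp.norm_apply_le v i
  have hj : |v j| ≤ ‖v‖ := PiLp.norm_apply_le v j
  calc |v i| * |v j| * |chartGram x u' i j - chartGram x u i j|
      ≤ ‖v‖ * ‖v‖ * (K * ‖u' - u‖) := by
        gcongr
        exact hG i j
    _ = K * ‖u' - u‖ * ‖v‖ ^ 2 := by ring

/-- Near each point, the Riemannian norms in a chart are equivalent to the Euclidean norm, and vary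
in a Lipschitz way. -/
lemma exists_chartNorm_control (x : Y) {u₀ : EuclideanSpace ℝ (Fin n)}
    (hu₀ : u₀ ∈ (chartAt (EuclideanSpace ℝ (Fin n)) x).target) :
    ∃ r > 0, ∃ K > 0, ∃ Λ > 0, Metric.ball u₀ r ⊆ (chartAt (EuclideanSpace ℝ (Fin n)) x).target ∧
      (∀ u ∈ Metric.ball u₀ r, ∀ v, ‖v‖ ≤ Λ * chartNorm x u v ∧ chartNorm x u v ≤ Λ * ‖v‖) ∧
      ∀ u ∈ Metric.ball u₀ r, ∀ u' ∈ Metric.ball u₀ r, ∀ v,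
        chartNorm x u' v ≤ (1 + K * ‖u' - u‖) * chartNorm x u v := by
  obtain ⟨r, hr, L, hL, hball, hlip⟩ := exists_abs_chartNorm_sq_sub_le x hu₀
  obtain ⟨T, hT, -⟩ := exists_linearMap_norm_eq_chartNorm x hu₀
  set A : ℝ := ‖(T : EuclideanSpace ℝ (Fin n) →L[ℝ] EuclideanSpace ℝ (Fin n))‖ +
    ‖(T.symm : EuclideanSpace ℝ (Fin n) →L[ℝ] EuclideanSpace ℝ (Fin n))‖ + 1 with hA
  have hA1 : 1 ≤ A := by
    rw [hA]
    linarith [norm_nonneg (T : EuclideanSpace ℝ (Fin n) →L[ℝ] EuclideanSpace ℝ (Fin n)),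
      norm_nonneg (T.symm : EuclideanSpace ℝ (Fin n) →L[ℝ] EuclideanSpace ℝ (Fin n))]
  have hup : ∀ v, chartNorm x u₀ v ≤ A * ‖v‖ := fun v ↦ by
    rw [← hT]
    refine ((T : EuclideanSpace ℝ (Fin n) →L[ℝ] EuclideanSpace ℝ (Fin n)).le_opNorm v).trans ?_
    gcongr
    rw [hA]
    linarith [norm_nonneg (T.symm : EuclideanSpace ℝ (Fin n) →L[ℝ] EuclideanSpace ℝ (Fin n))]
  have hlow : ∀ v, ‖v‖ ≤ A * chartNorm x u₀ v := fun v ↦ by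
    rw [← hT]
    have := (T.symm : EuclideanSpace ℝ (Fin n) →L[ℝ] EuclideanSpace ℝ (Fin n)).le_opNorm (T v)
    simp only [ContinuousLinearEquiv.coe_coe, ContinuousLinearEquiv.symm_apply_apply] at this
    refine this.trans ?_
    gcongr
    rw [hA]
    linarith [norm_nonneg (T : EuclideanSpace ℝ (Fin n) →L[ℝ] EuclideanSpace ℝ (Fin n))]
  -- On this ball the squared norm varies by at most `‖v‖² / (2A²)`, half of its lower bound `‖v‖² /
  -- A²` at `u₀`. The summand in `L + 1` covers `L = 0`.
  set ρ : ℝ := min r (1 / (2 * A ^ 2 * (L + 1))) with hρ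
  have hρ0 : 0 < ρ := lt_min hr (by positivity)
  have hsub : Metric.ball u₀ ρ ⊆ Metric.ball u₀ r := Metric.ball_subset_ball (min_le_left _ _)
  have hu₀r : u₀ ∈ Metric.ball u₀ r := Metric.mem_ball_self hr
  have hLρ : L * ρ ≤ 1 / (2 * A ^ 2) := by
    calc L * ρ ≤ (L + 1) * (1 / (2 * A ^ 2 * (L + 1))) := by
          gcongr
          · linarith
          · exact min_le_right _ _
      _ = 1 / (2 * A ^ 2) := by field_simp
  have hdiff : ∀ u ∈ Metric.ball u₀ ρ, ∀ v,
      |chartNorm x u v ^ 2 - chartNorm x u₀ v ^ 2| ≤ 1 / (2 * A ^ 2) * ‖v‖ ^ 2 := by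
    intro u hu v
    refine (hlip u₀ hu₀r u (hsub hu) v).trans ?_
    gcongr
    refine le_trans ?_ hLρ
    gcongr
    rw [← dist_eq_norm]; exact (Metric.mem_ball.1 hu).le
  have hbd : ∀ u ∈ Metric.ball u₀ ρ, ∀ v,
      ‖v‖ ≤ 2 * A * chartNorm x u v ∧ chartNorm x u v ≤ 2 * A * ‖v‖ := by
    intro u hu v
    have h1 := abs_le.1 (hdiff u hu v)
    have h2 : ‖v‖ ^ 2 ≤ A ^ 2 * chartNorm x u₀ v ^ 2 := by
      rw [← mul_pow]; gcongr; exact hlow v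
    have h3 : chartNorm x u₀ v ^ 2 ≤ A ^ 2 * ‖v‖ ^ 2 := by
      rw [← mul_pow]; gcongr
      · exact chartNorm_nonneg _ _ _
      · exact hup v
    have h4 : A ^ 2 * (1 / (2 * A ^ 2) * ‖v‖ ^ 2) = ‖v‖ ^ 2 / 2 := by field_simp
    have hA2 : 1 ≤ A ^ 2 := one_le_pow₀ hA1
    constructor
    · refine abs_le_of_sq_le_sq' ?_ (by have := chartNorm_nonneg x u v; positivity) |>.2
      have : A ^ 2 * (chartNorm x u₀ v ^ 2 - chartNorm x u v ^ 2) ≤ ‖v‖ ^ 2 / 2 := by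
        rw [← h4]; gcongr; linarith [h1.1]
      have h5 := sq_nonneg (A * chartNorm x u v)
      nlinarith
    · refine abs_le_of_sq_le_sq' ?_ (by positivity) |>.2
      have h6 : 1 / (2 * A ^ 2) * ‖v‖ ^ 2 ≤ A ^ 2 * ‖v‖ ^ 2 := by
        gcongr
        rw [div_le_iff₀ (by positivity)]; nlinarith
      have h7 : 0 ≤ A ^ 2 * ‖v‖ ^ 2 := by positivity
      nlinarith [h1.2]
  -- The additive Lipschitz bound on squares becomes multiplicative through `‖v‖ ≤ 2A · chartNorm x
  -- u v`, and `1 + t ≤ (1 + t)²` removes the squares. The extra `1` keeps `K` positive.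
  refine ⟨ρ, hρ0, L * (2 * A) ^ 2 + 1, by positivity, 2 * A, by positivity, hsub.trans hball, hbd, ?_⟩
  intro u hu u' hu' v
  have h1 := (abs_le.1 (hlip u (hsub hu) u' (hsub hu') v)).2
  have h2 : ‖v‖ ^ 2 ≤ (2 * A) ^ 2 * chartNorm x u v ^ 2 := by
    rw [← mul_pow]; gcongr; exact (hbd u hu v).1
  have h3 := chartNorm_nonneg x u v
  refine abs_le_of_sq_le_sq' ?_ (by positivity) |>.2
  set s := ‖u' - u‖
  have hs : 0 ≤ s := norm_nonneg _
  have h4 : L * s * ‖v‖ ^ 2 ≤ L * s * ((2 * A) ^ 2 * chartNorm x u v ^ 2) := by gcongr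
  have h5 : chartNorm x u' v ^ 2 ≤ (1 + L * (2 * A) ^ 2 * s) * chartNorm x u v ^ 2 := by linarith
  refine h5.trans ?_
  refine (mul_le_mul_of_nonneg_right ?_ (sq_nonneg _)).trans_eq (mul_pow _ _ _).symm
  have : 0 ≤ L * (2 * A) ^ 2 * s := by positivity
  nlinarith

end ChartControl

/-! ### Lengths of curves in a chart -/

section ChartCurves

variable {n : ℕ} {Y : Type*} [MetricSpace Y]
    [ChartedSpace (EuclideanSpace ℝ (Fin n)) Y]

lemma contMDiffOn_chart_symm_comp [IsManifold (𝓡 n) ∞ Y] (x : Y)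
    {c : ℝ → EuclideanSpace ℝ (Fin n)}
    (hc : ContDiffOn ℝ 1 c (Icc 0 1))
    (hmaps : MapsTo c (Icc 0 1) (chartAt (EuclideanSpace ℝ (Fin n)) x).target) :
    ContMDiffOn 𝓘(ℝ, ℝ) (𝓡 n) 1 ((chartAt (EuclideanSpace ℝ (Fin n)) x).symm ∘ c) (Icc 0 1) :=
  (contMDiffOn_chart_symm (I := 𝓡 n)).comp (contMDiffOn_iff_contDiffOn.2 hc) hmaps

variable [RiemannianBundle (fun y : Y ↦ TangentSpace (𝓡 n) y)]

/-- The Riemannian length of a curve defined on `[0, 1]`, in the preferred chart at `x`. -/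
def chartLength (x : Y) (c : ℝ → EuclideanSpace ℝ (Fin n)) : ℝ≥0∞ :=
  ∫⁻ t in Icc (0 : ℝ) 1, ENNReal.ofReal (chartNorm x (c t) (derivWithin c (Icc 0 1) t))

variable [IsManifold (𝓡 n) ∞ Y]

lemma pathELength_chart_symm_comp (x : Y) {c : ℝ → EuclideanSpace ℝ (Fin n)}
    (hc : ContDiffOn ℝ 1 c (Icc 0 1))
    (hmaps : MapsTo c (Icc 0 1) (chartAt (EuclideanSpace ℝ (Fin n)) x).target) :
    pathELength (𝓡 n) ((chartAt (EuclideanSpace ℝ (Fin n)) x).symm ∘ c) 0 1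
      = chartLength x c := by
  set e := chartAt (EuclideanSpace ℝ (Fin n)) x with he
  have hinv : e.MDifferentiable (𝓡 n) (𝓡 n) := mdifferentiable_chart (I := 𝓡 n) x
  rw [pathELength_eq_lintegral_mfderivWithin_Icc, chartLength]
  refine setLIntegral_congr_fun measurableSet_Icc fun t ht ↦ ?_
  have huniq : UniqueMDiffWithinAt 𝓘(ℝ, ℝ) (Icc (0 : ℝ) 1) t :=
    (uniqueDiffOn_Icc zero_lt_one t ht).uniqueMDiffWithinAt
  have hcd : MDifferentiableWithinAt 𝓘(ℝ, ℝ) (𝓡 n) c (Icc 0 1) t :=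
    (hc.differentiableOn one_ne_zero t ht).mdifferentiableWithinAt
  have h1 : mfderivWithin 𝓘(ℝ, ℝ) (𝓡 n) (e.symm ∘ c) (Icc 0 1) t =
      (mfderiv (𝓡 n) (𝓡 n) e.symm (c t)).comp (mfderivWithin 𝓘(ℝ, ℝ) (𝓡 n) c (Icc 0 1) t) :=
    mfderiv_comp_mfderivWithin t (hinv.mdifferentiableAt_symm (hmaps ht)) hcd huniq
  have h2 : mfderivWithin 𝓘(ℝ, ℝ) (𝓡 n) (e.symm ∘ c) (Icc 0 1) t 1 =
      mfderiv (𝓡 n) (𝓡 n) e.symm (c t) (derivWithin c (Icc 0 1) t) := by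
    have h3 : (mfderivWithin 𝓘(ℝ, ℝ) (𝓡 n) c (Icc 0 1) t (1 : ℝ) : EuclideanSpace ℝ (Fin n))
        = derivWithin c (Icc 0 1) t := by
      rw [mfderivWithin_eq_fderivWithin]
      exact fderivWithin_derivWithin
    rw [h1]
    exact congrArg (fun w : EuclideanSpace ℝ (Fin n) ↦ mfderiv (𝓡 n) (𝓡 n) e.symm (c t) w) h3
  beta_reduce
  rw [h2, chartNorm, ofReal_norm]
  rfl

lemma exists_chart_curve (x : Y) {γ : ℝ → Y} (hγ : ContMDiffOn 𝓘(ℝ, ℝ) (𝓡 n) 1 γ (Icc 0 1))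
    (hmaps : MapsTo γ (Icc 0 1) (chartAt (EuclideanSpace ℝ (Fin n)) x).source) :
    ContDiffOn ℝ 1 (chartAt (EuclideanSpace ℝ (Fin n)) x ∘ γ) (Icc 0 1) ∧
      chartLength x (chartAt (EuclideanSpace ℝ (Fin n)) x ∘ γ) = pathELength (𝓡 n) γ 0 1 := by
  set e := chartAt (EuclideanSpace ℝ (Fin n)) x with he
  have h1 : ContDiffOn ℝ 1 (e ∘ γ) (Icc 0 1) :=
    contMDiffOn_iff_contDiffOn.1 ((contMDiffOn_chart (I := 𝓡 n)).comp hγ hmaps)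
  refine ⟨h1, ?_⟩
  rw [← pathELength_chart_symm_comp x h1 fun t ht ↦ e.map_source (hmaps ht)]
  exact pathELength_congr fun t ht ↦ e.left_inv (hmaps ht)

/-- A curve has connected image, so its endpoints lie in one component, where `d` is the infimum of
lengths. -/
lemma edist_le_chartLength (hd : IsRiemannianOnComponents n Y) (x : Y)
    {c : ℝ → EuclideanSpace ℝ (Fin n)} (hc : ContDiffOn ℝ 1 c (Icc 0 1))
    (hmaps : MapsTo c (Icc 0 1) (chartAt (EuclideanSpace ℝ (Fin n)) x).target) :
    edist ((chartAt (EuclideanSpace ℝ (Fin n)) x).symm (c 0))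
      ((chartAt (EuclideanSpace ℝ (Fin n)) x).symm (c 1)) ≤ chartLength x c := by
  have hs := contMDiffOn_chart_symm_comp x hc hmaps
  rw [hd, ← pathELength_chart_symm_comp x hc hmaps]
  · exact riemannianEDist_le_pathELength hs rfl rfl zero_le_one
  · exact (isPreconnected_Icc.image _ hs.continuousOn).subset_connectedComponent
      (mem_image_of_mem _ (left_mem_Icc.2 zero_le_one))
      (mem_image_of_mem _ (right_mem_Icc.2 zero_le_one))

/-- Almost minimizing curves between points close to `u₀` stay in a given neighborhood of `u₀`. -/
lemma exists_chartLength_lt (hd : IsRiemannianOnComponents n Y) (x : Y)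
    {u₀ : EuclideanSpace ℝ (Fin n)}
    (hu₀ : u₀ ∈ (chartAt (EuclideanSpace ℝ (Fin n)) x).target)
    {U : Set (EuclideanSpace ℝ (Fin n))} (hU : U ∈ 𝓝 u₀) :
    ∃ δ > 0, Metric.ball u₀ δ ⊆ (chartAt (EuclideanSpace ℝ (Fin n)) x).target ∧
      ∀ u ∈ Metric.ball u₀ δ, ∀ v ∈ Metric.ball u₀ δ, ∀ r : ℝ≥0∞,
      edist ((chartAt (EuclideanSpace ℝ (Fin n)) x).symm u)
        ((chartAt (EuclideanSpace ℝ (Fin n)) x).symm v) < r →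
      ∃ c : ℝ → EuclideanSpace ℝ (Fin n), c 0 = u ∧ c 1 = v ∧ ContDiffOn ℝ 1 c (Icc 0 1) ∧
        MapsTo c (Icc 0 1) U ∧ chartLength x c < r := by
  set e := chartAt (EuclideanSpace ℝ (Fin n)) x with he
  set y₀ := e.symm u₀ with hy₀
  have hy₀s : y₀ ∈ e.source := e.map_target hu₀
  have hV : e.source ∩ e ⁻¹' U ∈ 𝓝 y₀ := by
    refine inter_mem (e.open_source.mem_nhds hy₀s) ((e.continuousAt hy₀s).preimage_mem_nhds ?_)
    rwa [hy₀, e.right_inv hu₀]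
  obtain ⟨ρ, hρ, hball⟩ := Metric.mem_nhds_iff.1 hV
  have : LocallyConnectedSpace Y :=
    ChartedSpace.locallyConnectedSpace (EuclideanSpace ℝ (Fin n)) Y
  -- Two points within `ρ/3` of `y₀` are less than `2ρ/3` apart; a curve of length below `2ρ/3`
  -- starting at one of them cannot leave the ball of radius `ρ`. Components are open because `Y` is
  -- locally connected.
  have hW : e.target ∩ e.symm ⁻¹' (Metric.ball y₀ (ρ / 3) ∩ connectedComponent y₀) ∈ 𝓝 u₀ := by
    refine inter_mem (e.open_target.mem_nhds hu₀)
      ((e.continuousAt_symm hu₀).preimage_mem_nhds (inter_mem ?_ ?_))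
    · exact Metric.ball_mem_nhds _ (by positivity)
    · exact isOpen_connectedComponent.mem_nhds mem_connectedComponent
  obtain ⟨δ, hδ, hδW⟩ := Metric.mem_nhds_iff.1 hW
  refine ⟨δ, hδ, fun u hu ↦ (hδW hu).1, fun u hu v hv r hr ↦ ?_⟩
  obtain ⟨hut, hub, huc⟩ := hδW hu
  obtain ⟨hvt, hvb, hvc⟩ := hδW hv
  have hcc : connectedComponent (e.symm u) = connectedComponent y₀ := (connectedComponent_eq huc).symm
  have hr2 : edist (e.symm u) (e.symm v) < ENNReal.ofReal (2 * ρ / 3) := by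
    rw [edist_lt_ofReal]
    have := dist_triangle_right (e.symm u) (e.symm v) y₀
    rw [Metric.mem_ball] at hub hvb
    linarith
  have hlt : edist (e.symm u) (e.symm v) < min r (ENNReal.ofReal (2 * ρ / 3)) := lt_min hr hr2
  rw [hd _ _ (by rw [hcc]; exact hvc)] at hlt
  obtain ⟨γ, γ0, γ1, hγ, hlen⟩ := exists_lt_of_riemannianEDist_lt hlt
  have hstay : ∀ t ∈ Icc (0 : ℝ) 1, γ t ∈ Metric.ball y₀ ρ := by
    intro t ht
    have hsub : Icc 0 t ⊆ Icc (0 : ℝ) 1 := Icc_subset_Icc le_rfl ht.2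
    have h1 : edist (e.symm u) (γ t) < ENNReal.ofReal (2 * ρ / 3) := by
      rw [hd]
      · calc riemannianEDist (𝓡 n) (e.symm u) (γ t) ≤ pathELength (𝓡 n) γ 0 t :=
              riemannianEDist_le_pathELength (hγ.mono hsub) γ0 rfl ht.1
          _ ≤ pathELength (𝓡 n) γ 0 1 := pathELength_mono le_rfl ht.2
          _ < _ := hlen
          _ ≤ _ := min_le_right _ _
      · exact (isPreconnected_Icc.image _ hγ.continuousOn).subset_connectedComponent
          ⟨0, left_mem_Icc.2 zero_le_one, γ0⟩ (mem_image_of_mem _ ht)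
    rw [edist_lt_ofReal] at h1
    rw [Metric.mem_ball] at hub ⊢
    have := dist_triangle_left (γ t) y₀ (e.symm u)
    linarith
  have hmaps : MapsTo γ (Icc 0 1) e.source := fun t ht ↦ (hball (hstay t ht)).1
  obtain ⟨hc, hclen⟩ := exists_chart_curve x hγ hmaps
  refine ⟨e ∘ γ, ?_, ?_, hc, fun t ht ↦ (hball (hstay t ht)).2, ?_⟩
  · simp [γ0, e.right_inv hut]
  · simp [γ1, e.right_inv hvt]
  · rw [hclen]; exact hlen.trans_le (min_le_left _ _)

end ChartCurves

/-- This stands in for minimizing curves: an estimate obtained from curves of length less than `r`,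
for every `r > d`, passes to `d`. -/
lemma ENNReal.le_mul_of_forall_gt {a M d : ℝ≥0∞} (hM₀ : M ≠ 0) (hM : M ≠ ⊤)
    (h : ∀ r, d < r → a ≤ M * r) : a ≤ M * d := by
  have : a / M ≤ d := le_of_forall_gt_imp_ge_of_dense fun r hr ↦ ENNReal.div_le_of_le_mul' (h r hr)
  rwa [ENNReal.div_le_iff' hM₀ hM] at this

lemma dist_le_mul_dist_of_edist_le {X Z : Type*} [PseudoMetricSpace X] [PseudoMetricSpace Z]
    {a b : X} {c d : Z} {M : ℝ} (hM : 0 ≤ M)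
    (h : edist a b ≤ ENNReal.ofReal M * edist c d) : dist a b ≤ M * dist c d := by
  rw [edist_dist, edist_dist, ← ENNReal.ofReal_mul hM] at h
  exact (ENNReal.ofReal_le_ofReal_iff (by positivity)).1 h

/-! ### The distance in a chart -/

section ChartDistance

variable {n : ℕ} {Y : Type*} [MetricSpace Y]
    [ChartedSpace (EuclideanSpace ℝ (Fin n)) Y]
    [RiemannianBundle (fun y : Y ↦ TangentSpace (𝓡 n) y)] [IsManifold (𝓡 n) ∞ Y]

/-- An affine map which is infinitesimally `M`-Lipschitz for the Riemannian norms is locally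
`M`-Lipschitz for the Riemannian distance. -/
lemma exists_dist_chart_symm_map_le (hd : IsRiemannianOnComponents n Y) (x : Y)
    {u₀ : EuclideanSpace ℝ (Fin n)}
    (hu₀ : u₀ ∈ (chartAt (EuclideanSpace ℝ (Fin n)) x).target)
    {U : Set (EuclideanSpace ℝ (Fin n))} (hU : U ∈ 𝓝 u₀) :
    ∃ δ > 0, Metric.ball u₀ δ ⊆ (chartAt (EuclideanSpace ℝ (Fin n)) x).target ∧
      ∀ u ∈ Metric.ball u₀ δ, ∀ v ∈ Metric.ball u₀ δ,
      ∀ (T : EuclideanSpace ℝ (Fin n) →L[ℝ] EuclideanSpace ℝ (Fin n))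
        (b : EuclideanSpace ℝ (Fin n)) (M : ℝ), 0 < M →
      (∀ p ∈ U, T p + b ∈ (chartAt (EuclideanSpace ℝ (Fin n)) x).target ∧
        ∀ w, chartNorm x (T p + b) (T w) ≤ M * chartNorm x p w) →
      dist ((chartAt (EuclideanSpace ℝ (Fin n)) x).symm (T u + b))
        ((chartAt (EuclideanSpace ℝ (Fin n)) x).symm (T v + b)) ≤
      M * dist ((chartAt (EuclideanSpace ℝ (Fin n)) x).symm u)
        ((chartAt (EuclideanSpace ℝ (Fin n)) x).symm v) := by
  -- The radius is fixed before `T`, `b` and `M`, since the contraction used later depends on the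
  -- points themselves.
  obtain ⟨δ, hδ, hδt, h⟩ := exists_chartLength_lt hd x hu₀ hU
  refine ⟨δ, hδ, hδt, fun u hu v hv T b M hM hT ↦ ?_⟩
  refine dist_le_mul_dist_of_edist_le hM.le
    (ENNReal.le_mul_of_forall_gt (by simpa using hM) ENNReal.ofReal_ne_top fun r hr ↦ ?_)
  obtain ⟨c, c0, c1, hc, hcU, hlen⟩ := h u hu v hv r hr
  have hc' : ContDiffOn ℝ 1 (fun t ↦ T (c t) + b) (Icc 0 1) :=
    (T.contDiff.comp_contDiffOn hc).add contDiffOn_const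
  have h1 := edist_le_chartLength hd x hc' fun t ht ↦ (hT _ (hcU ht)).1
  simp only [c0, c1] at h1
  refine h1.trans (le_trans ?_ (mul_le_mul_right hlen.le _))
  rw [chartLength, chartLength, ← lintegral_const_mul' _ _ ENNReal.ofReal_ne_top]
  refine setLIntegral_mono' measurableSet_Icc fun t ht ↦ ?_
  rw [← ENNReal.ofReal_mul hM.le]
  refine ENNReal.ofReal_le_ofReal ?_
  have hder : derivWithin (fun t ↦ T (c t) + b) (Icc 0 1) t = T (derivWithin c (Icc 0 1) t) := by
    have h2 := (hc.differentiableOn one_ne_zero t ht).hasDerivWithinAt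
    exact ((T.hasFDerivAt.comp_hasDerivWithinAt t h2).add_const b).derivWithin
      (uniqueDiffOn_Icc zero_lt_one t ht)
  rw [hder]
  exact (hT _ (hcU ht)).2 _

variable [IsContMDiffRiemannianBundle (𝓡 n) ∞ (EuclideanSpace ℝ (Fin n))
      (fun y : Y ↦ TangentSpace (𝓡 n) y)]

/-- Near a point, the distance of `Y` is infinitesimally close to the distance given by the
Riemannian norm at this point. -/
lemma exists_dist_chart_symm_le_and_le (hd : IsRiemannianOnComponents n Y) (x : Y)
    {u₀ : EuclideanSpace ℝ (Fin n)}
    (hu₀ : u₀ ∈ (chartAt (EuclideanSpace ℝ (Fin n)) x).target) {ε : ℝ} (hε : 0 < ε) :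
    ∃ δ > 0, Metric.ball u₀ δ ⊆ (chartAt (EuclideanSpace ℝ (Fin n)) x).target ∧
      ∀ u ∈ Metric.ball u₀ δ, ∀ v ∈ Metric.ball u₀ δ,
      dist ((chartAt (EuclideanSpace ℝ (Fin n)) x).symm u)
        ((chartAt (EuclideanSpace ℝ (Fin n)) x).symm v) ≤ (1 + ε) * chartNorm x u₀ (u - v) ∧
      chartNorm x u₀ (u - v) ≤ (1 + ε) * dist ((chartAt (EuclideanSpace ℝ (Fin n)) x).symm u)
        ((chartAt (EuclideanSpace ℝ (Fin n)) x).symm v) := by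
  obtain ⟨r, hr, K, hK, -, -, hball, -, hctrl⟩ := exists_chartNorm_control x hu₀
  obtain ⟨T, hT, -⟩ := exists_linearMap_norm_eq_chartNorm x hu₀
  set ρ := min r (ε / K) with hρdef
  have hρ : 0 < ρ := lt_min hr (by positivity)
  have hfac : ∀ u ∈ Metric.ball u₀ ρ, 1 + K * ‖u - u₀‖ ≤ 1 + ε := by
    intro u hu
    have h1 : ‖u - u₀‖ ≤ ε / K := by
      rw [← dist_eq_norm]
      exact (Metric.mem_ball.1 hu).le.trans (min_le_right _ _)
    rw [le_div_iff₀ hK] at h1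
    linarith
  have hsub : Metric.ball u₀ ρ ⊆ Metric.ball u₀ r := Metric.ball_subset_ball (min_le_left _ _)
  have hu₀r : u₀ ∈ Metric.ball u₀ r := Metric.mem_ball_self hr
  have hup : ∀ u ∈ Metric.ball u₀ ρ, ∀ w, chartNorm x u w ≤ (1 + ε) * chartNorm x u₀ w :=
    fun u hu w ↦ (hctrl u₀ hu₀r u (hsub hu) w).trans
      (mul_le_mul_of_nonneg_right (hfac u hu) (chartNorm_nonneg _ _ _))
  have hlow : ∀ u ∈ Metric.ball u₀ ρ, ∀ w, chartNorm x u₀ w ≤ (1 + ε) * chartNorm x u w :=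
    fun u hu w ↦ (hctrl u (hsub hu) u₀ hu₀r w).trans
      (mul_le_mul_of_nonneg_right (by rw [norm_sub_rev]; exact hfac u hu) (chartNorm_nonneg _ _ _))
  obtain ⟨δ, hδ, hδt, h⟩ := exists_chartLength_lt hd x hu₀ (Metric.ball_mem_nhds u₀ hρ)
  refine ⟨min δ ρ, lt_min hδ hρ, (Metric.ball_subset_ball (min_le_left _ _)).trans hδt,
    fun u hu v hv ↦ ⟨?_, ?_⟩⟩
  -- Upper bound: the straight segment stays in the ball, where norms exceed those at `u₀` by a
  -- factor at most `1 + ε`.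
  · let c : ℝ → EuclideanSpace ℝ (Fin n) := fun t ↦ v + t • (u - v)
    have hmaps : MapsTo c (Icc 0 1) (Metric.ball u₀ ρ) := fun t ht ↦
      (convex_ball u₀ ρ).add_smul_sub_mem (Metric.ball_subset_ball (min_le_right _ _) hv)
        (Metric.ball_subset_ball (min_le_right _ _) hu) ht
    have hc : ContDiffOn ℝ 1 c (Icc 0 1) := by fun_prop
    have h1 := edist_le_chartLength hd x hc fun t ht ↦ hball (hsub (hmaps ht))
    have h2 : chartLength x c ≤ ENNReal.ofReal ((1 + ε) * chartNorm x u₀ (u - v)) := by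
      calc chartLength x c
          ≤ ∫⁻ t in Icc (0 : ℝ) 1, ENNReal.ofReal ((1 + ε) * chartNorm x u₀ (u - v)) := by
            refine setLIntegral_mono' measurableSet_Icc fun t ht ↦ ENNReal.ofReal_le_ofReal ?_
            have hder : derivWithin c (Icc 0 1) t = u - v := by
              have := ((hasDerivAt_id t).smul_const (u - v)).const_add v
              rw [one_smul] at this
              exact this.hasDerivWithinAt.derivWithin (uniqueDiffOn_Icc zero_lt_one t ht)
            rw [hder]
            exact hup _ (hmaps ht) _
        _ = _ := by simp
    have h3 := h1.trans h2
    rw [edist_dist, ENNReal.ofReal_le_ofReal_iff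
      (mul_nonneg (by positivity) (chartNorm_nonneg _ _ _)), dist_comm] at h3
    simpa [c] using h3
  -- Lower bound: `T` makes the norm at `u₀` Euclidean, and the Euclidean length of `T ∘ c` is at
  -- least the distance between its endpoints.
  · rw [← hT, map_sub, ← dist_eq_norm]
    refine dist_le_mul_dist_of_edist_le (by positivity)
      (ENNReal.le_mul_of_forall_gt (by simp; positivity) ENNReal.ofReal_ne_top fun r hr ↦ ?_)
    obtain ⟨c, c0, c1, hc, hcU, hlen⟩ := h u (Metric.ball_subset_ball (min_le_left _ _) hu)
      v (Metric.ball_subset_ball (min_le_left _ _) hv) r hr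
    have hTc : ContDiffOn ℝ 1 (fun t ↦ T (c t)) (Icc 0 1) := T.contDiff.comp_contDiffOn hc
    have h1 := enorm_sub_le_lintegral_derivWithin_Icc_of_contDiffOn_Icc hTc zero_le_one
    simp only [c0, c1] at h1
    rw [edist_comm, edist_eq_enorm_sub]
    refine h1.trans (le_trans ?_ (mul_le_mul_right hlen.le _))
    rw [chartLength, ← lintegral_const_mul' _ _ ENNReal.ofReal_ne_top]
    refine setLIntegral_mono' measurableSet_Icc fun t ht ↦ ?_
    rw [← ENNReal.ofReal_mul (by positivity), ← ofReal_norm]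
    refine ENNReal.ofReal_le_ofReal ?_
    have hder : derivWithin (fun t ↦ T (c t)) (Icc 0 1) t = T (derivWithin c (Icc 0 1) t) := by
      have h2 := (hc.differentiableOn one_ne_zero t ht).hasDerivWithinAt
      exact (T.hasFDerivAt.comp_hasDerivWithinAt t h2).derivWithin
        (uniqueDiffOn_Icc zero_lt_one t ht)
    rw [hder, hT]
    exact hlow _ (hcU ht) _

end ChartDistance

/-- A rank one operator mapping `a` to `b`, with controlled norm. -/
lemma exists_rankOne_continuousLinearMap {E : Type*} [NormedAddCommGroup E]
    [InnerProductSpace ℝ E] (a b : E) (ha : 0 < ‖a‖) :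
    ∃ (S : E →L[ℝ] E) (k : E → ℝ), (∀ p, S p = k p • b) ∧ k a = 1 ∧ ∀ p, |k p| ≤ ‖p‖ / ‖a‖ := by
  refine ⟨(‖a‖ ^ 2)⁻¹ • (innerSL ℝ a).smulRight b, fun p ↦ (‖a‖ ^ 2)⁻¹ * inner ℝ a p,
    fun p ↦ by simp [smul_smul], ?_, fun p ↦ ?_⟩
  · beta_reduce
    rw [real_inner_self_eq_norm_sq, inv_mul_cancel₀ (by positivity)]
  · rw [abs_mul, abs_of_pos (by positivity : 0 < (‖a‖ ^ 2)⁻¹)]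
    calc (‖a‖ ^ 2)⁻¹ * |inner ℝ a p| ≤ (‖a‖ ^ 2)⁻¹ * (‖a‖ * ‖p‖) := by
          gcongr; exact abs_real_inner_le_norm a p
      _ = ‖p‖ / ‖a‖ := by field_simp

/-! ### Separating nearby points by a ball of definite size -/

section Transversal

variable {n : ℕ} {Y : Type*} [MetricSpace Y]
    [ChartedSpace (EuclideanSpace ℝ (Fin n)) Y]
    [RiemannianBundle (fun y : Y ↦ TangentSpace (𝓡 n) y)] [IsManifold (𝓡 n) ∞ Y]
    [IsContMDiffRiemannianBundle (𝓡 n) ∞ (EuclideanSpace ℝ (Fin n))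
      (fun y : Y ↦ TangentSpace (𝓡 n) y)]

set_option maxHeartbeats 1000000 in
/-- Given two points `u ≠ v` close to `u₀`, there is a ball of definite size, lying in the
direction of `v` as seen from `u`, whose points are closer to `v` than to `u` by a definite
proportion of the distance between `u` and `v`. For `z` in this ball, we shorten the curves from
`u` to `z` by a linear contraction with center `z` mapping `u` to `v`. -/
lemma exists_ball_mul_dist_le_dist_sub_dist (hd : IsRiemannianOnComponents n Y) (x : Y)
    {u₀ : EuclideanSpace ℝ (Fin n)}
    (hu₀ : u₀ ∈ (chartAt (EuclideanSpace ℝ (Fin n)) x).target) {R : ℝ} (hR : 0 < R) :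
    ∃ δ > 0, ∃ r > 0, ∃ c > 0, ∀ u ∈ Metric.ball u₀ δ, ∀ v ∈ Metric.ball u₀ δ, u ≠ v →
      ∃ z₀, Metric.ball z₀ r ⊆ Metric.ball u₀ R ∧ ∀ z ∈ Metric.ball z₀ r,
        c * dist ((chartAt (EuclideanSpace ℝ (Fin n)) x).symm u)
            ((chartAt (EuclideanSpace ℝ (Fin n)) x).symm v) ≤
          dist ((chartAt (EuclideanSpace ℝ (Fin n)) x).symm u)
            ((chartAt (EuclideanSpace ℝ (Fin n)) x).symm z) -
          dist ((chartAt (EuclideanSpace ℝ (Fin n)) x).symm v)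
            ((chartAt (EuclideanSpace ℝ (Fin n)) x).symm z) := by
  set e := chartAt (EuclideanSpace ℝ (Fin n)) x with he
  obtain ⟨ρ, hρ, K, hK, Λ, hΛ, hball, hbd, hctrl⟩ := exists_chartNorm_control x hu₀
  obtain ⟨δ₁, hδ₁, -, hbilip⟩ := exists_dist_chart_symm_le_and_le hd x hu₀ one_pos
  -- The affine map below moves points by at most `(8/3) s R₁`. So `R₁ ≤ ρ/4` keeps images in the
  -- controlled ball, and `K R₁ ≤ 1/8` bounds the relative change of the metric by `s/3`.
  set R₁ := min (ρ / 4) (1 / (8 * K)) with hR₁def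
  have hR₁ : 0 < R₁ := lt_min (by positivity) (by positivity)
  have hR₁ρ : R₁ ≤ ρ / 4 := min_le_left _ _
  have hKR₁ : K * R₁ ≤ 1 / 8 := by
    have : R₁ ≤ 1 / (8 * K) := min_le_right _ _
    rw [le_div_iff₀ (by positivity)] at this
    linarith
  obtain ⟨δ₂, hδ₂, -, hmap⟩ := exists_dist_chart_symm_map_le hd x hu₀ (Metric.ball_mem_nhds u₀ hR₁)
  obtain ⟨D, hD, hDδ₁, hDδ₂, hDR₁, hDR⟩ : ∃ D > 0, D ≤ δ₁ ∧ D ≤ δ₂ ∧ D ≤ R₁ ∧ D ≤ R :=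
    ⟨min (min δ₁ δ₂) (min R₁ R), by positivity, (min_le_left _ _).trans (min_le_left _ _),
      (min_le_left _ _).trans (min_le_right _ _), (min_le_right _ _).trans (min_le_left _ _),
      (min_le_right _ _).trans (min_le_right _ _)⟩
  -- The ball of centres `z` has radius `η q`; the factor `Λ²` pays for passing from the Riemannian
  -- norm to the Euclidean one and back when bounding the correction `S`.
  obtain ⟨η, hη, hη4, hηΛ⟩ : ∃ η > 0, η ≤ 1 / 4 ∧ Λ ^ 2 * η ≤ 1 / 4 := by
    refine ⟨min (1 / 4) (1 / (4 * Λ ^ 2)), lt_min (by norm_num) (by positivity),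
      min_le_left _ _, ?_⟩
    calc Λ ^ 2 * min (1 / 4) (1 / (4 * Λ ^ 2)) ≤ Λ ^ 2 * (1 / (4 * Λ ^ 2)) := by
          gcongr; exact min_le_right _ _
      _ = 1 / 4 := by field_simp
  set q := D / 4 with hq
  have hq0 : 0 < q := by positivity
  refine ⟨D / 8, by positivity, η * q, by positivity, 1 / (16 * Λ ^ 2), by positivity,
    fun u hu v hv huv ↦ ?_⟩
  rw [Metric.mem_ball, dist_eq_norm] at hu hv
  set w := v - u with hw
  have hw0 : 0 < ‖w‖ := norm_pos_iff.2 (sub_ne_zero.2 huv.symm)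
  have hwq : ‖w‖ ≤ q := by
    have : w = (v - u₀) - (u - u₀) := by rw [hw]; abel
    rw [this]
    linarith [norm_sub_le (v - u₀) (u - u₀)]
  set s := ‖w‖ / q with hs
  have hs0 : 0 < s := by positivity
  have hs1 : s ≤ 1 := (div_le_one hq0).2 hwq
  have hsq : s * q = ‖w‖ := by rw [hs]; field_simp
  -- The homothety of centre `z₀` and ratio `1 - s` maps `u` exactly to `v`, and `z₀` is at
  -- Euclidean distance `q` from `u` however close `v` is.
  set z₀ := u + s⁻¹ • w with hz₀
  have hz₀u : ‖z₀ - u‖ = q := by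
    rw [hz₀, add_sub_cancel_left, norm_smul, norm_inv, Real.norm_of_nonneg hs0.le, ← hsq]
    field_simp
  have hηq : η * q ≤ q / 4 := by nlinarith
  have hz₀D : Metric.ball z₀ (η * q) ⊆ Metric.ball u₀ D := by
    intro z hz
    rw [Metric.mem_ball, dist_eq_norm] at hz ⊢
    have : z - u₀ = (z - z₀) + (z₀ - u) + (u - u₀) := by abel
    rw [this]
    linarith [norm_add₃_le (a := z - z₀) (b := z₀ - u) (c := u - u₀)]
  refine ⟨z₀, hz₀D.trans (Metric.ball_subset_ball hDR), fun z hz ↦ ?_⟩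
  have hzD := hz₀D hz
  have huD : u ∈ Metric.ball u₀ D := by
    rw [Metric.mem_ball, dist_eq_norm]; linarith
  have hvD : v ∈ Metric.ball u₀ D := by
    rw [Metric.mem_ball, dist_eq_norm]; linarith
  set a := u - z with ha
  -- For a general centre `z` the homothety of ratio `1 - s` misses `v` by `b = s • (z₀ - z)`. The
  -- rank one map `S`, sending `a` to `b`, corrects this; its size is a small multiple of `s`.
  set b := w + s • a with hb
  have hbn : ‖b‖ ≤ s * (η * q) := by
    have : b = s • (z₀ - z) := by
      rw [hb, ha, hz₀, smul_sub, smul_sub, smul_add, smul_inv_smul₀ hs0.ne']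
      abel
    rw [this, norm_smul, Real.norm_of_nonneg hs0.le]
    rw [Metric.mem_ball, dist_eq_norm, norm_sub_rev] at hz
    gcongr
  have han : 3 / 4 * q ≤ ‖a‖ := by
    have h1 : z₀ - u = (z₀ - z) - a := by rw [ha]; abel
    rw [Metric.mem_ball, dist_eq_norm, norm_sub_rev] at hz
    have := norm_sub_le (z₀ - z) a
    rw [← h1, hz₀u] at this
    linarith
  have ha0 : 0 < ‖a‖ := lt_of_lt_of_le (by positivity) han
  have hba : ‖b‖ ≤ 4 / 3 * s * η * ‖a‖ := by
    have : s * η * (3 / 4 * q) ≤ s * η * ‖a‖ := by gcongr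
    linarith
  obtain ⟨S, k, hSapp, hka, hcoef⟩ := exists_rankOne_continuousLinearMap a b ha0
  have hSn : ∀ p, ‖S p‖ ≤ s / 3 * ‖p‖ := fun p ↦ by
    rw [hSapp, norm_smul, Real.norm_eq_abs]
    calc _ ≤ ‖p‖ / ‖a‖ * (4 / 3 * s * η * ‖a‖) := by gcongr; exact hcoef p
      _ = 4 / 3 * s * η * ‖p‖ := by field_simp
      _ ≤ 4 / 3 * s * (1 / 4) * ‖p‖ := by gcongr
      _ = _ := by ring
  let T : EuclideanSpace ℝ (Fin n) →L[ℝ] EuclideanSpace ℝ (Fin n) :=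
    (1 - s) • ContinuousLinearMap.id ℝ _ + S
  have hTapp : ∀ p, T p = (1 - s) • p + S p := fun p ↦ by simp [T]
  have hTa : T a = a + w := by
    rw [hTapp, hSapp, hka, one_smul, hb, sub_smul, one_smul]
    abel
  have hTu : T u + (z - T z) = v := by
    have : T u + (z - T z) = T a + z := by rw [ha, map_sub]; abel
    rw [this, hTa, ha, hw]; abel
  have hTz : T z + (z - T z) = z := by abel
  have hM : 0 < 1 - s / 3 := by linarith
  have key := hmap u (Metric.ball_subset_ball hDδ₂ huD) z (Metric.ball_subset_ball hDδ₂ hzD) T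
    (z - T z) (1 - s / 3) hM ?_
  · rw [hTu, hTz] at key
    obtain ⟨-, h1⟩ := hbilip u (Metric.ball_subset_ball hDδ₁ huD) z
      (Metric.ball_subset_ball hDδ₁ hzD)
    obtain ⟨h2, -⟩ := hbilip u (Metric.ball_subset_ball hDδ₁ huD) v
      (Metric.ball_subset_ball hDδ₁ hvD)
    rw [← he] at h1 h2
    rw [← ha] at h1
    have hu₀ρ : u₀ ∈ Metric.ball u₀ ρ := Metric.mem_ball_self hρ
    have h3 := (hbd u₀ hu₀ρ a).1
    have h4 := (hbd u₀ hu₀ρ (u - v)).2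
    rw [norm_sub_rev, ← hw] at h4
    have h5 : 3 / 4 * q ≤ Λ * (2 * dist (e.symm u) (e.symm z)) := by
      refine han.trans (h3.trans ?_)
      gcongr
      linarith
    have h6 : s * (3 / 4 * q) ≤ s * (Λ * (2 * dist (e.symm u) (e.symm z))) := by gcongr
    have h7 : dist (e.symm u) (e.symm v) ≤ 2 * Λ * ‖w‖ := by linarith
    -- The gain is at least `(s/3) d(u,z)`, while `d(u,v) ≤ 2Λ s q` and `(3/4) q ≤ 2Λ d(u,z)` give
    -- `d(u,v) ≤ (16/3) Λ² s d(u,z)`; hence the constant `1 / (16Λ²)`.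
    rw [div_mul_eq_mul_div, one_mul, div_le_iff₀ (by positivity)]
    have h8 : dist (e.symm u) (e.symm v) ≤ 16 / 3 * Λ ^ 2 * (s * dist (e.symm u) (e.symm z)) := by
      have : 2 * Λ * (s * (3 / 4 * q)) ≤ 2 * Λ * (s * (Λ * (2 * dist (e.symm u) (e.symm z)))) := by
        gcongr
      have h9 : 2 * Λ * (s * (3 / 4 * q)) = 3 / 4 * (2 * Λ * ‖w‖) := by rw [← hsq]; ring
      rw [h9] at this
      linarith
    have h10 : s / 3 * dist (e.symm u) (e.symm z) * (16 * Λ ^ 2) ≤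
        (dist (e.symm u) (e.symm z) - dist (e.symm v) (e.symm z)) * (16 * Λ ^ 2) := by
      gcongr
      linarith
    linarith
  · intro p hp
    have hpz : ‖p - z‖ ≤ 2 * R₁ := by
      have h1 : p - z = (p - u₀) - (z - u₀) := by abel
      rw [Metric.mem_ball, dist_eq_norm] at hp hzD
      rw [h1]
      linarith [norm_sub_le (p - u₀) (z - u₀)]
    -- The displacement is proportional to `s`, so the error from changing base point has the order
    -- of the gain and a small chart makes it a fraction of it.
    have hmove : T p + (z - T z) - p = S (p - z) - s • (p - z) := by
      have : T p + (z - T z) = T (p - z) + z := by rw [map_sub]; abel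
      rw [this, hTapp, sub_smul, one_smul]; abel
    have hmoven : ‖T p + (z - T z) - p‖ ≤ 8 / 3 * s * R₁ := by
      rw [hmove]
      refine (norm_sub_le _ _).trans ?_
      rw [norm_smul, Real.norm_of_nonneg hs0.le]
      have h1 := hSn (p - z)
      have : s * ‖p - z‖ ≤ s * (2 * R₁) := by gcongr
      linarith
    have hTpρ : T p + (z - T z) ∈ Metric.ball u₀ ρ := by
      have h1 : T p + (z - T z) - u₀ = (T p + (z - T z) - p) + (p - u₀) := by abel
      rw [Metric.mem_ball, dist_eq_norm] at hp ⊢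
      rw [h1]
      have : s * R₁ ≤ 1 * R₁ := by gcongr
      linarith [norm_add_le (T p + (z - T z) - p) (p - u₀)]
    have hpρ : p ∈ Metric.ball u₀ ρ := Metric.ball_subset_ball (by linarith) hp
    refine ⟨hball hTpρ, fun y ↦ ?_⟩
    have hNy := chartNorm_nonneg x p y
    have hNS : chartNorm x p (S y) ≤ s / 3 * chartNorm x p y := by
      rw [hSapp, chartNorm_smul]
      calc _ ≤ ‖y‖ / ‖a‖ * (Λ * (4 / 3 * s * η * ‖a‖)) := by
            gcongr
            · exact chartNorm_nonneg _ _ _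
            · exact hcoef y
            · exact (hbd p hpρ b).2.trans (by gcongr)
        _ = 4 / 3 * s * η * Λ * ‖y‖ := by field_simp
        _ ≤ 4 / 3 * s * η * Λ * (Λ * chartNorm x p y) := by gcongr; exact (hbd p hpρ y).1
        _ = 4 / 3 * s * (Λ ^ 2 * η) * chartNorm x p y := by ring
        _ ≤ 4 / 3 * s * (1 / 4) * chartNorm x p y := by gcongr
        _ = _ := by ring
    have hNT : chartNorm x p (T y) ≤ (1 - 2 * s / 3) * chartNorm x p y := by
      rw [hTapp]
      refine (chartNorm_add_le _ _ _ _).trans ?_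
      rw [chartNorm_smul, abs_of_nonneg (by linarith)]
      linarith
    refine (hctrl p hpρ _ hTpρ (T y)).trans ?_
    have hKs : K * ‖T p + (z - T z) - p‖ ≤ s / 3 := by
      have h1 : K * ‖T p + (z - T z) - p‖ ≤ K * (8 / 3 * s * R₁) := by gcongr
      have h2 : 8 / 3 * s * (K * R₁) ≤ 8 / 3 * s * (1 / 8) := by gcongr
      linarith
    -- The homothety gains `s`, the correction `S` loses `s/3` and the change of base point loses
    -- another `s/3`, which leaves the ratio `1 - s/3`.
    calc (1 + K * ‖T p + (z - T z) - p‖) * chartNorm x p (T y)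
        ≤ (1 + s / 3) * ((1 - 2 * s / 3) * chartNorm x p y) := by
          gcongr
          exact chartNorm_nonneg _ _ _
      _ = ((1 + s / 3) * (1 - 2 * s / 3)) * chartNorm x p y := by ring
      _ ≤ (1 - s / 3) * chartNorm x p y := by
          gcongr
          nlinarith

end Transversal

/-! ### Local comparison of measures; Hausdorff measure of Euclidean space -/

section MeasureComparison

/-- A local comparison of measures is a global comparison. -/
lemma MeasureTheory.measure_le_of_forall_exists_isOpen {X : Type*} [TopologicalSpace X]
    [SecondCountableTopology X] [MeasurableSpace X] [OpensMeasurableSpace X] {μ ν : Measure X}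
    {S : Set X}
    (h : ∀ x ∈ S, ∃ U, IsOpen U ∧ x ∈ U ∧ ∀ B ⊆ U, MeasurableSet B → μ B ≤ ν B)
    {B : Set X} (hB : MeasurableSet B) (hBS : B ⊆ S) : μ B ≤ ν B := by
  choose! U hUo hxU hU using h
  -- By the Lindelöf property countably many `U` cover `S`; making them disjoint cuts `B` into
  -- pieces on which the inequality is known.
  obtain ⟨t, htS, htc, hcov⟩ := TopologicalSpace.countable_cover_nhdsWithin (f := U) (s := S)
    fun x hx ↦ mem_nhdsWithin_of_mem_nhds ((hUo x hx).mem_nhds (hxU x hx))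
  rcases t.eq_empty_or_nonempty with rfl | htn
  · have : B = ∅ := by
      simp only [mem_empty_iff_false, iUnion_of_empty, iUnion_empty, subset_empty_iff] at hcov
      exact subset_empty_iff.1 (hcov ▸ hBS)
    simp [this]
  obtain ⟨f, hf⟩ := htc.exists_eq_range htn
  have hfS : ∀ k, f k ∈ S := fun k ↦ htS (hf ▸ mem_range_self k)
  let V : ℕ → Set X := disjointed fun k ↦ U (f k)
  have hVm : ∀ k, MeasurableSet (V k) :=
    MeasurableSet.disjointed fun k ↦ (hUo _ (hfS k)).measurableSet
  have hBV : B = ⋃ k, B ∩ V k := by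
    rw [← inter_iUnion, iUnion_disjointed]
    refine (inter_eq_left.2 (hBS.trans (hcov.trans ?_))).symm
    rw [hf, biUnion_range]
  have hdisj : Pairwise (Function.onFun Disjoint fun k ↦ B ∩ V k) := fun i j hij ↦
    (disjoint_disjointed (fun k ↦ U (f k)) hij).mono inter_subset_right inter_subset_right
  rw [hBV, measure_iUnion hdisj fun k ↦ hB.inter (hVm k),
    measure_iUnion hdisj fun k ↦ hB.inter (hVm k)]
  exact ENNReal.tsum_le_tsum fun k ↦ hU _ (hfS k) _
    (inter_subset_right.trans (disjointed_subset (fun k ↦ U (f k)) k)) (hB.inter (hVm k))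

lemma ENNReal.le_of_forall_pos_le_one_add_pow_mul {a b : ℝ≥0∞} (m : ℕ)
    (h : ∀ ε : ℝ, 0 < ε → a ≤ ENNReal.ofReal (1 + ε) ^ m * b) : a ≤ b := by
  have h1 : Tendsto (fun ε : ℝ ↦ ENNReal.ofReal (1 + ε) ^ m * b) (𝓝[>] 0) (𝓝 (1 * b)) := by
    refine ENNReal.Tendsto.mul_const ?_ (Or.inl one_ne_zero)
    have : Continuous fun ε : ℝ ↦ ENNReal.ofReal (1 + ε) ^ m := by
      exact (ENNReal.continuous_pow m).comp (ENNReal.continuous_ofReal.comp (by fun_prop))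
    have := (this.tendsto 0).mono_left (nhdsWithin_le_nhds (s := Ioi 0))
    simpa using this
  rw [one_mul] at h1
  exact ge_of_tendsto h1 (eventually_mem_nhdsWithin.mono fun ε hε ↦ h ε hε)

instance isAddHaarMeasure_hausdorffMeasure_euclideanSpace (n : ℕ) :
    (μH[(n : ℝ)] : Measure (EuclideanSpace ℝ (Fin n))).IsAddHaarMeasure := by
  have := isAddHaarMeasure_hausdorffMeasure (E := EuclideanSpace ℝ (Fin n))
  rwa [finrank_euclideanSpace_fin] at this

/-- The ratio between the Lebesgue measure and the `n`-dimensional Hausdorff measure of the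
Euclidean space of dimension `n`. -/
def euclideanHausdorffRatio (n : ℕ) : ℝ≥0 :=
  Measure.addHaarScalarFactor (volume : Measure (EuclideanSpace ℝ (Fin n))) μH[(n : ℝ)]

lemma euclideanHausdorffRatio_pos (n : ℕ) : 0 < euclideanHausdorffRatio n :=
  Measure.addHaarScalarFactor_pos_of_isAddHaarMeasure _ _

lemma volume_eq_euclideanHausdorffRatio_smul (n : ℕ) :
    (volume : Measure (EuclideanSpace ℝ (Fin n))) = euclideanHausdorffRatio n • μH[(n : ℝ)] :=
  Measure.isAddLeftInvariant_eq_smul _ _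

end MeasureComparison

/-! ### The Riemannian volume as a Hausdorff measure -/

section ChartVolume

variable {n : ℕ} {Y : Type*} [MetricSpace Y] [MeasurableSpace Y] [BorelSpace Y]
    [ChartedSpace (EuclideanSpace ℝ (Fin n)) Y]

lemma measurableSet_chart_symm_preimage_inter_target (x : Y) {A : Set Y} (hA : MeasurableSet A) :
    MeasurableSet ((chartAt (EuclideanSpace ℝ (Fin n)) x).symm ⁻¹' A ∩
        (chartAt (EuclideanSpace ℝ (Fin n)) x).target) := by
  set e := chartAt (EuclideanSpace ℝ (Fin n)) x with he
  have hm : MeasurableSet e.target := e.open_target.measurableSet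
  have h1 : Measurable (e.target.domRestrict e.symm) :=
    (continuousOn_iff_continuous_domRestrict.1 e.continuousOn_symm).measurable
  have h2 := hm.subtype_image (h1 hA)
  rwa [domRestrict_eq, preimage_comp, Subtype.image_preimage_coe, inter_comm] at h2

variable [RiemannianBundle (fun y : Y ↦ TangentSpace (𝓡 n) y)]

lemma riemannianVolumeInChart_apply (x : Y) {A : Set Y} (hA : MeasurableSet A) :
    riemannianVolumeInChart (n := n) x A =
      ∫⁻ u in (chartAt (EuclideanSpace ℝ (Fin n)) x).symm ⁻¹' A ∩
        (chartAt (EuclideanSpace ℝ (Fin n)) x).target, ENNReal.ofReal (riemannianDensity x u) := by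
  set e := chartAt (EuclideanSpace ℝ (Fin n)) x with he
  have hm : MeasurableSet e.target := e.open_target.measurableSet
  rw [riemannianVolumeInChart, Measure.map_apply_of_aemeasurable _ hA, withDensity_apply',
    Measure.restrict_restrict' hm]
  exact (e.continuousOn_symm.aemeasurable hm).mono_ac (withDensity_absolutelyContinuous _ _)

end ChartVolume

section ChartMeasure

variable {n : ℕ} {Y : Type*} [MetricSpace Y]
    [ChartedSpace (EuclideanSpace ℝ (Fin n)) Y]
    [RiemannianBundle (fun y : Y ↦ TangentSpace (𝓡 n) y)] [IsManifold (𝓡 n) ∞ Y]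

lemma riemannianDensity_pos (x : Y) {u : EuclideanSpace ℝ (Fin n)}
    (hu : u ∈ (chartAt (EuclideanSpace ℝ (Fin n)) x).target) : 0 < riemannianDensity x u := by
  obtain ⟨T, -, hT⟩ := exists_linearMap_norm_eq_chartNorm x hu
  rw [← hT, abs_pos]
  exact T.toLinearEquiv.isUnit_det'.ne_zero

variable [IsContMDiffRiemannianBundle (𝓡 n) ∞ (EuclideanSpace ℝ (Fin n))
      (fun y : Y ↦ TangentSpace (𝓡 n) y)]

lemma continuousOn_riemannianDensity (x : Y) :
    ContinuousOn (riemannianDensity x) (chartAt (EuclideanSpace ℝ (Fin n)) x).target := by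
  have : ContinuousOn (chartGram x) (chartAt (EuclideanSpace ℝ (Fin n)) x).target :=
    continuousOn_pi.2 fun i ↦ continuousOn_pi.2 fun j ↦ (contDiffOn_chartGram x i j).continuousOn
  exact Real.continuous_sqrt.comp_continuousOn
    ((Continuous.matrix_det continuous_id).comp_continuousOn this)

variable [MeasurableSpace Y] [BorelSpace Y]

/-- Near a point, the Hausdorff measure in a chart is close to the Lebesgue measure scaled by the
Riemannian density at this point. -/
lemma exists_hausdorffMeasure_chart_symm_image_le_and_le (hd : IsRiemannianOnComponents n Y)
    (x : Y) {u₀ : EuclideanSpace ℝ (Fin n)}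
    (hu₀ : u₀ ∈ (chartAt (EuclideanSpace ℝ (Fin n)) x).target) {ε : ℝ} (hε : 0 < ε) :
    ∃ δ > 0, Metric.ball u₀ δ ⊆ (chartAt (EuclideanSpace ℝ (Fin n)) x).target ∧
      ∀ B ⊆ Metric.ball u₀ δ,
      μH[(n : ℝ)] ((chartAt (EuclideanSpace ℝ (Fin n)) x).symm '' B) ≤
        ENNReal.ofReal (1 + ε) ^ n * (ENNReal.ofReal (riemannianDensity x u₀) * μH[(n : ℝ)] B) ∧
      ENNReal.ofReal (riemannianDensity x u₀) * μH[(n : ℝ)] B ≤ ENNReal.ofReal (1 + ε) ^ n *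
        μH[(n : ℝ)] ((chartAt (EuclideanSpace ℝ (Fin n)) x).symm '' B) := by
  set e := chartAt (EuclideanSpace ℝ (Fin n)) x with he
  obtain ⟨T, hT, hdet⟩ := exists_linearMap_norm_eq_chartNorm x hu₀
  obtain ⟨δ, hδ, hδt, hdist⟩ := exists_dist_chart_symm_le_and_le hd x hu₀ hε
  refine ⟨δ, hδ, hδt, fun B hB ↦ ?_⟩
  have hTB : μH[(n : ℝ)] (T '' B) = ENNReal.ofReal (riemannianDensity x u₀) * μH[(n : ℝ)] B := by
    rw [Measure.addHaar_image_continuousLinearEquiv, ← hdet]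
  have hdT : ∀ u v, dist (T u) (T v) = chartNorm x u₀ (u - v) := fun u v ↦ by
    rw [dist_eq_norm, ← map_sub, hT]
  have hK : ((Real.toNNReal (1 + ε) : ℝ≥0) : ℝ) = 1 + ε := Real.coe_toNNReal _ (by positivity)
  -- After `T`, which scales the Hausdorff measure by the density at `u₀`, the chart and its inverse
  -- are `(1+ε)`-Lipschitz, and such a map multiplies `μH[n]` by at most `(1+ε)^n`.
  have hlip : LipschitzOnWith (Real.toNNReal (1 + ε)) (e.symm ∘ T.symm) (T '' B) := by
    refine LipschitzOnWith.of_dist_le_mul ?_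
    rintro _ ⟨u, hu, rfl⟩ _ ⟨v, hv, rfl⟩
    rw [hK, hdT]
    simpa using (hdist u (hB hu) v (hB hv)).1
  have hlip' : LipschitzOnWith (Real.toNNReal (1 + ε)) (T ∘ e) (e.symm '' B) := by
    refine LipschitzOnWith.of_dist_le_mul ?_
    rintro _ ⟨u, hu, rfl⟩ _ ⟨v, hv, rfl⟩
    rw [hK, Function.comp_apply, Function.comp_apply, e.right_inv (hδt (hB hu)),
      e.right_inv (hδt (hB hv)), hdT]
    exact (hdist u (hB hu) v (hB hv)).2
  have h1 := hlip.hausdorffMeasure_image_le (d := (n : ℝ)) (by positivity)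
  have h2 := hlip'.hausdorffMeasure_image_le (d := (n : ℝ)) (by positivity)
  have him : (e.symm ∘ T.symm) '' (T '' B) = e.symm '' B := by
    rw [image_comp, T.symm_image_image]
  have him' : (T ∘ e) '' (e.symm '' B) = T '' B := by
    rw [image_comp]
    congr 1
    rw [← image_comp]
    refine (image_congr fun u hu ↦ ?_).trans (image_id B)
    exact e.right_inv (hδt (hB hu))
  rw [him, hTB, ENNReal.rpow_natCast] at h1
  rw [him', hTB, ENNReal.rpow_natCast] at h2
  exact ⟨h1, h2⟩

/-- Near a point, the Riemannian volume in a chart is close to the Hausdorff measure. -/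
lemma exists_riemannianVolumeInChart_le_and_le (hd : IsRiemannianOnComponents n Y)
    (x : Y) {y : Y} (hy : y ∈ (chartAt (EuclideanSpace ℝ (Fin n)) x).source)
    {ε : ℝ} (hε : 0 < ε) :
    ∃ U, IsOpen U ∧ y ∈ U ∧ ∀ B ⊆ U, MeasurableSet B →
      riemannianVolumeInChart (n := n) x B ≤
        (ENNReal.ofReal (1 + ε) ^ (n + 1) • (euclideanHausdorffRatio n • μH[(n : ℝ)])) B ∧
      (euclideanHausdorffRatio n • μH[(n : ℝ)]) B ≤
        (ENNReal.ofReal (1 + ε) ^ (n + 1) • riemannianVolumeInChart (n := n) x) B := by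
  set e := chartAt (EuclideanSpace ℝ (Fin n)) x with he
  set u₀ := e y with hu₀def
  have hu₀ : u₀ ∈ e.target := e.map_source hy
  obtain ⟨δ, hδ, hδt, hμ⟩ := exists_hausdorffMeasure_chart_symm_image_le_and_le hd x hu₀ hε
  have hpos := riemannianDensity_pos x hu₀
  have hcont := (continuousOn_riemannianDensity x).continuousAt (e.open_target.mem_nhds hu₀)
  -- Freezing the density at `u₀` costs one factor `1 + ε`, besides the `n` coming from the
  -- Lipschitz bounds: hence the exponent `n + 1`.
  have hW : ∀ᶠ u in 𝓝 u₀, riemannianDensity x u < (1 + ε) * riemannianDensity x u₀ ∧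
      riemannianDensity x u₀ < (1 + ε) * riemannianDensity x u := by
    refine (hcont.eventually_lt continuousAt_const (by nlinarith)).and
      (continuousAt_const.eventually_lt (hcont.const_mul _) (by nlinarith))
  obtain ⟨δ', hδ', hball⟩ := Metric.mem_nhds_iff.1 hW
  refine ⟨e.source ∩ e ⁻¹' Metric.ball u₀ (min δ δ'),
    e.isOpen_inter_preimage Metric.isOpen_ball,
    ⟨hy, Metric.mem_ball_self (lt_min hδ hδ')⟩, fun B hB hBm ↦ ?_⟩
  rw [Measure.smul_apply, Measure.smul_apply, Measure.smul_apply, smul_eq_mul, smul_eq_mul,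
    ENNReal.smul_def, smul_eq_mul, riemannianVolumeInChart_apply x hBm, ← he]
  have hB'm := measurableSet_chart_symm_preimage_inter_target (n := n) x hBm
  rw [← he] at hB'm
  set B' := e.symm ⁻¹' B ∩ e.target with hB'
  have hB'b : B' ⊆ Metric.ball u₀ (min δ δ') := by
    rintro u ⟨huB, hut⟩
    have := (hB huB).2
    rwa [mem_preimage, e.right_inv hut] at this
  have him : e.symm '' B' = B := by
    rw [hB', e.symm_image_eq_source_inter_preimage inter_subset_right]
    ext z
    constructor
    · rintro ⟨hz, hz', -⟩
      rwa [mem_preimage, e.left_inv hz] at hz'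
    · intro hz
      have hzs := (hB hz).1
      refine ⟨hzs, ?_, e.map_source hzs⟩
      rwa [mem_preimage, e.left_inv hzs]
  obtain ⟨h1, h2⟩ := hμ B' (hB'b.trans (Metric.ball_subset_ball (min_le_left _ _)))
  rw [← he, him] at h1 h2
  have hvol : volume B' = euclideanHausdorffRatio n * μH[(n : ℝ)] B' := by
    rw [volume_eq_euclideanHausdorffRatio_smul, Measure.smul_apply, ENNReal.smul_def, smul_eq_mul]
  set a := ENNReal.ofReal (1 + ε) with ha
  set k : ℝ≥0∞ := (euclideanHausdorffRatio n : ℝ≥0∞) with hk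
  set D := ENNReal.ofReal (riemannianDensity x u₀) with hD
  have hb := fun u (hu : u ∈ B') ↦ hball (Metric.ball_subset_ball (min_le_right _ _) (hB'b hu))
  constructor
  · calc ∫⁻ u in B', ENNReal.ofReal (riemannianDensity x u)
        ≤ ∫⁻ u in B', a * D := by
          refine setLIntegral_mono' hB'm fun u hu ↦ ?_
          rw [ha, hD, ← ENNReal.ofReal_mul (by positivity)]
          exact ENNReal.ofReal_le_ofReal (hb u hu).1.le
      _ = a * k * (D * μH[(n : ℝ)] B') := by
          rw [setLIntegral_const, hvol]; ring
      _ ≤ a * k * (a ^ n * μH[(n : ℝ)] B) := by gcongr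
      _ = _ := by ring
  · calc k * μH[(n : ℝ)] B ≤ k * (a ^ n * (D * μH[(n : ℝ)] B')) := by gcongr
      _ = a ^ n * ∫⁻ u in B', D := by rw [setLIntegral_const, hvol]; ring
      _ ≤ a ^ n * ∫⁻ u in B', a * ENNReal.ofReal (riemannianDensity x u) := by
          gcongr 1
          refine setLIntegral_mono' hB'm fun u hu ↦ ?_
          rw [ha, hD, ← ENNReal.ofReal_mul (by positivity)]
          exact ENNReal.ofReal_le_ofReal (hb u hu).2.le
      _ = _ := by
          rw [lintegral_const_mul' _ _ ENNReal.ofReal_ne_top]; ring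

/-- The Riemannian volume in a chart is a multiple of the Hausdorff measure. -/
lemma riemannianVolumeInChart_eq_hausdorffMeasure [SecondCountableTopology Y]
    (hd : IsRiemannianOnComponents n Y) (x : Y) :
    riemannianVolumeInChart (n := n) x = (euclideanHausdorffRatio n • μH[(n : ℝ)]).restrict
      (chartAt (EuclideanSpace ℝ (Fin n)) x).source := by
  set e := chartAt (EuclideanSpace ℝ (Fin n)) x with he
  have key : ∀ B ⊆ e.source, MeasurableSet B →
      riemannianVolumeInChart (n := n) x B = (euclideanHausdorffRatio n • μH[(n : ℝ)]) B := by
    intro B hBs hB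
    -- For fixed `ε` the local comparisons have the same constant at every point, so they globalise
    -- without loss; only then does `ε` tend to `0`.
    refine le_antisymm (ENNReal.le_of_forall_pos_le_one_add_pow_mul (n + 1) fun ε hε ↦ ?_)
      (ENNReal.le_of_forall_pos_le_one_add_pow_mul (n + 1) fun ε hε ↦ ?_)
    · refine measure_le_of_forall_exists_isOpen (S := e.source)
        (ν := ENNReal.ofReal (1 + ε) ^ (n + 1) • (euclideanHausdorffRatio n • μH[(n : ℝ)]))
        (fun y hy ↦ ?_) hB hBs
      obtain ⟨U, hU, hyU, h⟩ := exists_riemannianVolumeInChart_le_and_le hd x hy hε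
      exact ⟨U, hU, hyU, fun A hA hAm ↦ (h A hA hAm).1⟩
    · refine measure_le_of_forall_exists_isOpen (S := e.source)
        (ν := ENNReal.ofReal (1 + ε) ^ (n + 1) • riemannianVolumeInChart (n := n) x)
        (fun y hy ↦ ?_) hB hBs
      obtain ⟨U, hU, hyU, h⟩ := exists_riemannianVolumeInChart_le_and_le hd x hy hε
      exact ⟨U, hU, hyU, fun A hA hAm ↦ (h A hA hAm).2⟩
  ext A hA
  rw [Measure.restrict_apply hA, ← key _ inter_subset_right (hA.inter e.open_source.measurableSet),
    riemannianVolumeInChart_apply x hA,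
    riemannianVolumeInChart_apply x (hA.inter e.open_source.measurableSet)]
  congr 2
  ext u
  constructor
  · rintro ⟨h1, h2⟩
    exact ⟨⟨h1, e.map_target h2⟩, h2⟩
  · rintro ⟨h1, h2⟩
    exact ⟨h1.1, h2⟩

/-- The Riemannian volume is a multiple of the Hausdorff measure. -/
lemma riemannianVolume_eq_hausdorffMeasure [SecondCountableTopology Y]
    (hd : IsRiemannianOnComponents n Y) :
    riemannianVolume n Y = euclideanHausdorffRatio n • μH[(n : ℝ)] := by
  refine le_antisymm (iSup_le fun x ↦ ?_) ?_
  · rw [riemannianVolumeInChart_eq_hausdorffMeasure hd]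
    exact Measure.restrict_le_self
  · refine Measure.le_intro fun B hB _ ↦ ?_
    refine measure_le_of_forall_exists_isOpen (S := univ) (fun x _ ↦ ?_) hB (subset_univ _)
    refine ⟨(chartAt (EuclideanSpace ℝ (Fin n)) x).source,
      (chartAt (EuclideanSpace ℝ (Fin n)) x).open_source, mem_chart_source _ x, fun A hA hAm ↦ ?_⟩
    calc (euclideanHausdorffRatio n • μH[(n : ℝ)]) A = riemannianVolumeInChart (n := n) x A := by
          rw [riemannianVolumeInChart_eq_hausdorffMeasure hd, Measure.restrict_apply hAm,
            inter_eq_left.2 hA]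
      _ ≤ riemannianVolume n Y A := le_iSup (fun x : Y ↦ riemannianVolumeInChart (n := n) x) x A

/-- The comparison with Hausdorff measure in a chart gives local finiteness, and compactness does
the rest. -/
lemma isFiniteMeasure_riemannianVolume [CompactSpace Y] (hd : IsRiemannianOnComponents n Y) :
    IsFiniteMeasure (riemannianVolume n Y) := by
  rw [riemannianVolume_eq_hausdorffMeasure hd]
  have : IsLocallyFiniteMeasure (euclideanHausdorffRatio n • (μH[(n : ℝ)] : Measure Y)) := by
    refine ⟨fun y ↦ ?_⟩
    set e := chartAt (EuclideanSpace ℝ (Fin n)) y with he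
    obtain ⟨δ, hδ, hδt, hμ⟩ := exists_hausdorffMeasure_chart_symm_image_le_and_le hd y
      (mem_chart_target _ y) one_pos
    refine ⟨e.symm '' Metric.ball (e y) δ, ?_, ?_⟩
    · rw [e.symm_image_eq_source_inter_preimage hδt]
      exact (e.isOpen_inter_preimage Metric.isOpen_ball).mem_nhds
        ⟨mem_chart_source _ y, Metric.mem_ball_self hδ⟩
    · rw [Measure.smul_apply, ENNReal.smul_def, smul_eq_mul]
      refine ENNReal.mul_lt_top ENNReal.coe_lt_top ((hμ _ subset_rfl).1.trans_lt ?_)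
      exact ENNReal.mul_lt_top (ENNReal.pow_lt_top ENNReal.ofReal_lt_top)
        (ENNReal.mul_lt_top ENNReal.ofReal_lt_top measure_ball_lt_top)
  infer_instance

/-- Near a point, the Riemannian volume of the balls in a chart is bounded below. -/
lemma exists_le_riemannianVolume_chart_symm_image_ball [SecondCountableTopology Y]
    (hd : IsRiemannianOnComponents n Y) (x : Y) {u₀ : EuclideanSpace ℝ (Fin n)}
    (hu₀ : u₀ ∈ (chartAt (EuclideanSpace ℝ (Fin n)) x).target) :
    ∃ δ > 0, Metric.ball u₀ δ ⊆ (chartAt (EuclideanSpace ℝ (Fin n)) x).target ∧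
      ∀ r > 0, ∃ m : ℝ≥0∞, 0 < m ∧ ∀ z, Metric.ball z r ⊆ Metric.ball u₀ δ →
        m ≤ riemannianVolume n Y
          ((chartAt (EuclideanSpace ℝ (Fin n)) x).symm '' Metric.ball z r) := by
  obtain ⟨δ, hδ, hδt, hμ⟩ := exists_hausdorffMeasure_chart_symm_image_le_and_le hd x hu₀ one_pos
  refine ⟨δ, hδ, hδt, fun r hr ↦ ?_⟩
  have hk : (euclideanHausdorffRatio n : ℝ≥0∞) ≠ 0 := by
    exact_mod_cast (euclideanHausdorffRatio_pos n).ne'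
  set a : ℝ≥0∞ := ENNReal.ofReal (1 + 1) ^ n with ha
  have ha0 : a ≠ 0 := pow_ne_zero _ (by simp)
  have hat : a ≠ ⊤ := ENNReal.pow_ne_top ENNReal.ofReal_ne_top
  -- The bound is independent of `z` by translation invariance of the Euclidean Hausdorff measure;
  -- `a` is the distortion factor for `ε = 1`.
  refine ⟨euclideanHausdorffRatio n * (ENNReal.ofReal (riemannianDensity x u₀) *
    μH[(n : ℝ)] (Metric.ball (0 : EuclideanSpace ℝ (Fin n)) r) / a), ?_, fun z hz ↦ ?_⟩
  · refine ENNReal.mul_pos hk (ENNReal.div_pos (ENNReal.mul_pos ?_ ?_).ne' hat).ne'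
    · simpa using riemannianDensity_pos x hu₀
    · exact (Metric.measure_ball_pos _ _ hr).ne'
  · rw [riemannianVolume_eq_hausdorffMeasure hd, Measure.smul_apply, ENNReal.smul_def, smul_eq_mul]
    gcongr
    rw [ENNReal.div_le_iff' ha0 hat, ← Measure.addHaar_ball_center _ z]
    exact (hμ _ hz).2

lemma isOpenPosMeasure_riemannianVolume [SecondCountableTopology Y]
    (hd : IsRiemannianOnComponents n Y) :
    (riemannianVolume n Y).IsOpenPosMeasure := by
  refine ⟨fun O hO ⟨y, hy⟩ ↦ ?_⟩
  set e := chartAt (EuclideanSpace ℝ (Fin n)) y with he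
  obtain ⟨δ, hδ, hδt, hm⟩ :=
    exists_le_riemannianVolume_chart_symm_image_ball hd y (mem_chart_target _ y)
  have h1 : e.symm ⁻¹' O ∩ Metric.ball (e y) δ ∈ 𝓝 (e y) := by
    refine inter_mem ((e.continuousAt_symm (mem_chart_target _ y)).preimage_mem_nhds ?_)
      (Metric.ball_mem_nhds _ hδ)
    rw [e.left_inv (mem_chart_source _ y)]
    exact hO.mem_nhds hy
  obtain ⟨r, hr, hball⟩ := Metric.mem_nhds_iff.1 h1
  obtain ⟨m, hm0, hm⟩ := hm r hr
  refine ((hm0.trans_le (hm (e y) fun u hu ↦ (hball hu).2)).trans_le (measure_mono ?_)).ne'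
  rintro _ ⟨u, hu, rfl⟩
  exact (hball hu).1

end ChartMeasure

/-! ### The Kuratowski embedding of a compact metric space with a measure -/

section Kuratowski

variable {Y : Type*} [MetricSpace Y] [MeasurableSpace Y]

lemma mul_edist_le_lintegral_enorm_dist_sub_dist (μ : Measure Y) {B : Set Y}
    (hB : MeasurableSet B) {k : ℝ} (hk : 0 ≤ k) {x y : Y}
    (h : ∀ z ∈ B, k * dist x y ≤ |dist x z - dist y z|) :
    ENNReal.ofReal k * μ B * edist x y ≤ ∫⁻ z, ‖dist x z - dist y z‖ₑ ∂μ := by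
  calc ENNReal.ofReal k * μ B * edist x y
      = ∫⁻ _ in B, ENNReal.ofReal (k * dist x y) ∂μ := by
        rw [setLIntegral_const, ENNReal.ofReal_mul hk, ← edist_dist]; ring
    _ ≤ ∫⁻ z in B, ‖dist x z - dist y z‖ₑ ∂μ := by
        refine setLIntegral_mono' hB fun z hz ↦ ?_
        rw [← ofReal_norm, Real.norm_eq_abs]
        exact ENNReal.ofReal_le_ofReal (h z hz)
    _ ≤ ∫⁻ z, ‖dist x z - dist y z‖ₑ ∂μ := setLIntegral_le_lintegral _ _

/-- With `s = d(x₀,y₀)/8` and `x`, `z` within `s` of `x₀`, `y` within `s` of `y₀`, one has `d(x,z) <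
2s`, `d(y,z) > 6s` and `d(x,y) < 10s`; hence the ratio `2/5`. -/
lemma exists_mem_nhds_mul_edist_le_of_ne [BorelSpace Y] (μ : Measure Y) [μ.IsOpenPosMeasure]
    {x₀ y₀ : Y} (hne : x₀ ≠ y₀) :
    ∃ W ∈ 𝓝 (x₀, y₀), ∃ c : ℝ≥0∞, 0 < c ∧ ∀ q ∈ W,
      c * edist q.1 q.2 ≤ ∫⁻ z, ‖dist q.1 z - dist q.2 z‖ₑ ∂μ := by
  set s := dist x₀ y₀ / 8 with hs
  have hs0 : 0 < s := div_pos (dist_pos.2 hne) (by norm_num)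
  refine ⟨Metric.ball x₀ s ×ˢ Metric.ball y₀ s,
    prod_mem_nhds (Metric.ball_mem_nhds _ hs0) (Metric.ball_mem_nhds _ hs0),
    ENNReal.ofReal (2 / 5) * μ (Metric.ball x₀ s),
    ENNReal.mul_pos (by simp) (Metric.measure_ball_pos _ _ hs0).ne', ?_⟩
  rintro ⟨x, y⟩ ⟨hx, hy⟩
  refine mul_edist_le_lintegral_enorm_dist_sub_dist μ measurableSet_ball (by norm_num) fun z hz ↦ ?_
  simp only [Metric.mem_ball] at hx hy hz
  rw [abs_sub_comm]
  refine le_trans ?_ (le_abs_self _)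
  have h1 : dist x y ≤ dist x x₀ + dist x₀ y₀ + dist y₀ y := dist_triangle4 _ _ _ _
  have h2 : dist x z ≤ dist x x₀ + dist x₀ z := dist_triangle _ _ _
  have h3 : dist x₀ y₀ ≤ dist x₀ z + dist z y + dist y y₀ := dist_triangle4 _ _ _ _
  rw [dist_comm y₀ y] at h1
  rw [dist_comm x₀ z] at h2 h3
  rw [dist_comm z y] at h3
  linarith

/-- Having some positive constant is a property of sets of pairs that passes to subsets and finite
unions, so on the compact `Y × Y` it may be checked locally. Only the diagonal requires a
hypothesis. -/
lemma exists_mul_edist_le_lintegral_enorm_dist_sub_dist [CompactSpace Y] [BorelSpace Y]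
    (μ : Measure Y) [μ.IsOpenPosMeasure]
    (hdiag : ∀ x₀ : Y, ∃ V ∈ 𝓝 x₀, ∃ c : ℝ≥0∞, 0 < c ∧ ∀ x ∈ V, ∀ y ∈ V,
      c * edist x y ≤ ∫⁻ z, ‖dist x z - dist y z‖ₑ ∂μ) :
    ∃ c : ℝ≥0, 0 < c ∧ ∀ x y, c * edist x y ≤ ∫⁻ z, ‖dist x z - dist y z‖ₑ ∂μ := by
  have key : ∃ c : ℝ≥0∞, 0 < c ∧ ∀ q ∈ (univ : Set (Y × Y)),
      c * edist q.1 q.2 ≤ ∫⁻ z, ‖dist q.1 z - dist q.2 z‖ₑ ∂μ := by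
    refine isCompact_univ.induction_on (p := fun s : Set (Y × Y) ↦ ∃ c : ℝ≥0∞, 0 < c ∧ ∀ q ∈ s,
      c * edist q.1 q.2 ≤ ∫⁻ z, ‖dist q.1 z - dist q.2 z‖ₑ ∂μ) ?_ ?_ ?_ ?_
    · exact ⟨1, one_pos, fun q hq ↦ hq.elim⟩
    · rintro s t hst ⟨c, hc, h⟩
      exact ⟨c, hc, fun q hq ↦ h q (hst hq)⟩
    · rintro s t ⟨c, hc, h⟩ ⟨c', hc', h'⟩
      refine ⟨min c c', lt_min hc hc', ?_⟩
      rintro q (hq | hq)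
      · exact (mul_le_mul_left (min_le_left _ _) _).trans (h q hq)
      · exact (mul_le_mul_left (min_le_right _ _) _).trans (h' q hq)
    · rintro ⟨x₀, y₀⟩ -
      rw [nhdsWithin_univ]
      by_cases hne : x₀ = y₀
      · subst hne
        obtain ⟨V, hV, c, hc, h⟩ := hdiag x₀
        exact ⟨V ×ˢ V, prod_mem_nhds hV hV, c, hc, fun q hq ↦ h _ hq.1 _ hq.2⟩
      · exact exists_mem_nhds_mul_edist_le_of_ne μ hne
  obtain ⟨c, hc, h⟩ := key
  obtain ⟨c', hc', hcc'⟩ := ENNReal.lt_iff_exists_nnreal_btwn.1 hc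
  exact ⟨c', by exact_mod_cast hc',
    fun x y ↦ (mul_le_mul_left hcc'.le _).trans (h (x, y) (mem_univ _))⟩

lemma memLp_dist [CompactSpace Y] [BorelSpace Y] (μ : Measure Y) [IsFiniteMeasure μ] (p : ℝ≥0∞)
    (x : Y) :
    MemLp (fun z ↦ dist x z) p μ := by
  refine MemLp.of_bound (C := Metric.diam (univ : Set Y))
    (Continuous.aestronglyMeasurable (by fun_prop)) (ae_of_all _ fun z ↦ ?_)
  rw [Real.norm_of_nonneg dist_nonneg]
  exact Metric.dist_le_diam_of_mem isCompact_univ.isBounded (mem_univ _) (mem_univ _)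

/-- Source of the uniformity in `p`: the powers `μ(Y)^(1/p)` and `μ(Y)^(1-1/p)` are both at most
`max 1 (μ univ)`. -/
lemma ENNReal.rpow_le_max_one {a : ℝ≥0∞} {θ : ℝ} (h₀ : 0 ≤ θ) (h₁ : θ ≤ 1) :
    a ^ θ ≤ max 1 a :=
  calc a ^ θ ≤ (max 1 a) ^ θ := ENNReal.rpow_le_rpow (le_max_right _ _) h₀
    _ ≤ (max 1 a) ^ (1 : ℝ) := ENNReal.rpow_le_rpow_of_exponent_le (le_max_left _ _) h₁
    _ = max 1 a := ENNReal.rpow_one _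

lemma edist_lpKuratowskiEmbedding (μ : Measure Y) (p : ℝ≥0∞)
    (h : ∀ x : Y, MemLp (fun z ↦ dist x z) p μ) (x y : Y) :
    edist (lpKuratowskiEmbedding p μ h x) (lpKuratowskiEmbedding p μ h y) =
      eLpNorm (fun z ↦ dist x z - dist y z) p μ :=
  Lp.edist_toLp_toLp _ _ _ _

lemma eLpNorm_dist_sub_dist_le (μ : Measure Y) {p : ℝ≥0∞} (hp : 1 ≤ p) (hp' : p ≠ ⊤) (x y : Y) :
    eLpNorm (fun z ↦ dist x z - dist y z) p μ ≤ max 1 (μ univ) * edist x y := by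
  have hp1 : 1 ≤ p.toReal := by
    rwa [← ENNReal.toReal_one, ENNReal.toReal_le_toReal ENNReal.one_ne_top hp']
  rw [edist_dist]
  refine (eLpNorm_le_of_ae_bound (C := dist x y) (ae_of_all _ fun z ↦ ?_)).trans ?_
  · rw [Real.norm_eq_abs]
    exact abs_dist_sub_le x y z
  · gcongr
    exact ENNReal.rpow_le_max_one (by positivity) (inv_le_one_of_one_le₀ hp1)

lemma lintegral_enorm_dist_sub_dist_le [SecondCountableTopology Y] [BorelSpace Y]
    (μ : Measure Y) {p : ℝ≥0∞} (hp : 1 ≤ p) (hp' : p ≠ ⊤) (x y : Y) :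
    ∫⁻ z, ‖dist x z - dist y z‖ₑ ∂μ ≤
      max 1 (μ univ) * eLpNorm (fun z ↦ dist x z - dist y z) p μ := by
  have hp1 : 1 ≤ p.toReal := by
    rwa [← ENNReal.toReal_one, ENNReal.toReal_le_toReal ENNReal.one_ne_top hp']
  have hm : AEStronglyMeasurable (fun z ↦ dist x z - dist y z) μ :=
    Continuous.aestronglyMeasurable (by fun_prop)
  have h := eLpNorm_le_eLpNorm_mul_rpow_measure_univ hp hm
  rw [eLpNorm_one_eq_lintegral_enorm, mul_comm] at h
  refine h.trans ?_
  gcongr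
  have h1 : 1 / p.toReal ≤ 1 := (div_le_one (by positivity)).2 hp1
  exact ENNReal.rpow_le_max_one (by simpa using h1) (by simp)

end Kuratowski

/-! ### The representation on `L^p` and equivariance -/

section Linearisation

variable {Γ Y : Type*} [Group Γ] [MetricSpace Y] [MeasurableSpace Y] [MulAction Γ Y]

/-- The composite is a separate variable `h`, so that group identities such as `(γγ')⁻¹ = γ'⁻¹γ⁻¹`
enter as an equation of maps and no measure preservation proof has to be transported. -/
lemma MeasureTheory.Lp.compMeasurePreserving_compMeasurePreserving {X : Type*}
    [MeasurableSpace X] {μ : Measure X} {p : ℝ≥0∞} {f g h : X → X} (hf : MeasurePreserving f μ μ)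
    (hg : MeasurePreserving g μ μ) (hh : MeasurePreserving h μ μ) (hgf : g ∘ f = h)
    (F : Lp ℝ p μ) :
    Lp.compMeasurePreserving f hf (Lp.compMeasurePreserving g hg F) =
      Lp.compMeasurePreserving h hh F := by
  subst hgf
  obtain ⟨φ, hφ, rfl⟩ : ∃ (φ : X → ℝ) (hφ : MemLp φ p μ), F = hφ.toLp φ :=
    ⟨F, Lp.memLp F, (Lp.toLp_coeFn F (Lp.memLp F)).symm⟩
  rw [Lp.toLp_compMeasurePreserving, Lp.toLp_compMeasurePreserving,
    Lp.toLp_compMeasurePreserving]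
  rfl

lemma MeasureTheory.Lp.compMeasurePreserving_eq_self {X : Type*}
    [MeasurableSpace X] {μ : Measure X} {p : ℝ≥0∞} {f : X → X} (hf : MeasurePreserving f μ μ)
    (hfid : f = id) (F : Lp ℝ p μ) : Lp.compMeasurePreserving f hf F = F := by
  subst hfid
  obtain ⟨φ, hφ, rfl⟩ : ∃ (φ : X → ℝ) (hφ : MemLp φ p μ), F = hφ.toLp φ :=
    ⟨F, Lp.memLp F, (Lp.toLp_coeFn F (Lp.memLp F)).symm⟩
  rw [Lp.toLp_compMeasurePreserving]
  rfl

/-- The isometric representation of `Γ` on `L^p` given by a measure preserving action. -/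
def lpRepresentation (μ : Measure Y) (hμ : ∀ γ : Γ, MeasurePreserving (fun y : Y ↦ γ • y) μ μ)
    (p : ℝ≥0∞) [Fact (1 ≤ p)] : Γ →* (Lp ℝ p μ ≃ₗᵢ[ℝ] Lp ℝ p μ) where
  toFun γ :=
    { toFun := Lp.compMeasurePreservingₗᵢ ℝ _ (hμ γ⁻¹)
      invFun := Lp.compMeasurePreservingₗᵢ ℝ _ (hμ γ)
      map_add' := map_add _
      map_smul' := map_smul _
      left_inv := fun F ↦
        (Lp.compMeasurePreserving_compMeasurePreserving (hμ γ) (hμ γ⁻¹) (.id μ)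
          (by ext y; simp) F).trans (Lp.compMeasurePreserving_eq_self _ rfl F)
      right_inv := fun F ↦
        (Lp.compMeasurePreserving_compMeasurePreserving (hμ γ⁻¹) (hμ γ) (.id μ)
          (by ext y; simp) F).trans (Lp.compMeasurePreserving_eq_self _ rfl F)
      norm_map' := (Lp.compMeasurePreservingₗᵢ ℝ _ (hμ γ⁻¹)).norm_map }
  map_one' := by
    ext1 F
    exact Lp.compMeasurePreserving_eq_self (hμ 1⁻¹) (by ext y; simp) F
  map_mul' γ γ' := by
    ext1 F
    exact (Lp.compMeasurePreserving_compMeasurePreserving (hμ γ⁻¹) (hμ γ'⁻¹) (hμ (γ * γ')⁻¹)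
      (by ext y; simp [mul_smul]) F).symm

/-- Equivariance is the identity `d(γy, z) = d(y, γ⁻¹z)`. -/
lemma lpKuratowskiEmbedding_smul [IsIsometricSMul Γ Y] (μ : Measure Y)
    (hμ : ∀ γ : Γ, MeasurePreserving (fun y : Y ↦ γ • y) μ μ)
    (p : ℝ≥0∞) [Fact (1 ≤ p)] (h : ∀ x : Y, MemLp (fun z ↦ dist x z) p μ) (γ : Γ) (y : Y) :
    lpKuratowskiEmbedding p μ h (γ • y) =
      lpRepresentation μ hμ p γ (lpKuratowskiEmbedding p μ h y) := by
  have h1 : lpRepresentation μ hμ p γ (lpKuratowskiEmbedding p μ h y) =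
      ((h y).comp_measurePreserving (hμ γ⁻¹)).toLp _ :=
    Lp.toLp_compMeasurePreserving (h y) (hμ γ⁻¹)
  rw [h1, lpKuratowskiEmbedding]
  congr 1
  ext z
  simp only [Function.comp_apply]
  rw [← dist_smul γ y, smul_inv_smul]

end Linearisation

/-! ### Conclusion for Riemannian manifolds -/

section RiemannianKuratowski

variable {n : ℕ} {Y : Type*} [MetricSpace Y] [CompactSpace Y] [MeasurableSpace Y] [BorelSpace Y]
    [ChartedSpace (EuclideanSpace ℝ (Fin n)) Y] [IsManifold (𝓡 n) ∞ Y]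
    [RiemannianBundle (fun y : Y ↦ TangentSpace (𝓡 n) y)]
    [IsContMDiffRiemannianBundle (𝓡 n) ∞ (EuclideanSpace ℝ (Fin n))
      (fun y : Y ↦ TangentSpace (𝓡 n) y)]

/-- The separating ball has a radius independent of the two points, so its volume is bounded below;
integrating over it gives the bound near the diagonal. -/
lemma exists_mem_nhds_mul_edist_le_lintegral_riemannianVolume
    (hd : IsRiemannianOnComponents n Y) (x₀ : Y) :
    ∃ V ∈ 𝓝 x₀, ∃ c : ℝ≥0∞, 0 < c ∧ ∀ x ∈ V, ∀ y ∈ V,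
      c * edist x y ≤ ∫⁻ z, ‖dist x z - dist y z‖ₑ ∂(riemannianVolume n Y) := by
  set e := chartAt (EuclideanSpace ℝ (Fin n)) x₀ with he
  obtain ⟨R, hR, hRt, hm⟩ :=
    exists_le_riemannianVolume_chart_symm_image_ball hd x₀ (mem_chart_target _ x₀)
  obtain ⟨δ, hδ, r, hr, c, hc, h⟩ :=
    exists_ball_mul_dist_le_dist_sub_dist hd x₀ (mem_chart_target _ x₀) hR
  obtain ⟨m, hm0, hm⟩ := hm r hr
  rw [← he] at h hm hRt
  refine ⟨e.source ∩ e ⁻¹' Metric.ball (e x₀) δ,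
    (e.isOpen_inter_preimage Metric.isOpen_ball).mem_nhds
      ⟨mem_chart_source _ x₀, Metric.mem_ball_self hδ⟩,
    ENNReal.ofReal c * m, ENNReal.mul_pos (by simpa using hc) hm0.ne', ?_⟩
  rintro x ⟨hxs, hx⟩ y ⟨hys, hy⟩
  by_cases hxy : x = y
  · simp [hxy]
  obtain ⟨z₀, hz₀, hz⟩ := h _ hx _ hy fun heq ↦ hxy (e.injOn hxs hys heq)
  rw [e.left_inv hxs, e.left_inv hys] at hz
  have hBm : MeasurableSet (e.symm '' Metric.ball z₀ r) := by
    rw [e.symm_image_eq_source_inter_preimage (hz₀.trans hRt)]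
    exact (e.isOpen_inter_preimage Metric.isOpen_ball).measurableSet
  refine le_trans ?_ (mul_edist_le_lintegral_enorm_dist_sub_dist (riemannianVolume n Y) hBm hc.le
    (x := x) (y := y) ?_)
  · gcongr
    exact hm _ hz₀
  · rintro _ ⟨z, hzb, rfl⟩
    exact (hz z hzb).trans (le_abs_self _)

/-- The metric induced by the Kuratowski embedding in `L^p` is equivalent to the original one, with
constants independent of `p`. -/
lemma exists_lpKuratowskiEmbedding_bilipschitz (hd : IsRiemannianOnComponents n Y) :
    ∃ c C : ℝ, 0 < c ∧ 0 < C ∧ ∀ (p : ℝ≥0∞) [Fact (1 ≤ p)], p ≠ ⊤ →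
      ∃ h : ∀ x : Y, MemLp (fun z ↦ dist x z) p (riemannianVolume n Y),
        ∀ x y : Y,
          c * dist x y ≤ dist (lpKuratowskiEmbedding p (riemannianVolume n Y) h x)
            (lpKuratowskiEmbedding p (riemannianVolume n Y) h y) ∧
          dist (lpKuratowskiEmbedding p (riemannianVolume n Y) h x)
            (lpKuratowskiEmbedding p (riemannianVolume n Y) h y) ≤ C * dist x y := by
  have hfin := isFiniteMeasure_riemannianVolume hd
  have hpos := isOpenPosMeasure_riemannianVolume hd
  set μ := riemannianVolume n Y with hμ
  obtain ⟨c, hc, hlow⟩ := exists_mul_edist_le_lintegral_enorm_dist_sub_dist μ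
    (exists_mem_nhds_mul_edist_le_lintegral_riemannianVolume hd)
  obtain ⟨M, hM⟩ : ∃ M : ℝ≥0, (M : ℝ≥0∞) = max 1 (μ univ) :=
    ⟨_, ENNReal.coe_toNNReal (max_lt ENNReal.one_lt_top (measure_lt_top μ univ)).ne⟩
  have hM1 : (1 : ℝ) ≤ M := by
    have : (1 : ℝ≥0∞) ≤ M := hM ▸ le_max_left _ _
    exact_mod_cast this
  refine ⟨c / M, M, by positivity, by positivity, fun p hp hp' ↦ ⟨memLp_dist μ p, fun x y ↦ ?_⟩⟩
  constructor
  · have h1 := (hlow x y).trans (lintegral_enorm_dist_sub_dist_le μ hp.out hp' x y)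
    rw [← edist_lpKuratowskiEmbedding μ p (memLp_dist μ p), ← hM, edist_nndist, edist_nndist] at h1
    have h2 : (c : ℝ) * dist x y ≤ M * dist (lpKuratowskiEmbedding p μ (memLp_dist μ p) x)
        (lpKuratowskiEmbedding p μ (memLp_dist μ p) y) := by
      rw [dist_nndist, dist_nndist]
      exact_mod_cast h1
    rw [div_mul_eq_mul_div, div_le_iff₀ (by positivity)]
    linarith
  · have h1 := eLpNorm_dist_sub_dist_le μ hp.out hp' x y
    rw [← edist_lpKuratowskiEmbedding μ p (memLp_dist μ p), ← hM, edist_nndist, edist_nndist] at h1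
    rw [dist_nndist, dist_nndist]
    exact_mod_cast h1

/-- Isometries preserve Hausdorff measure; no smoothness of the action is needed. -/
lemma measurePreserving_smul_riemannianVolume (hd : IsRiemannianOnComponents n Y) {Γ : Type*}
    [Group Γ] [MulAction Γ Y] [IsIsometricSMul Γ Y] (γ : Γ) :
    MeasurePreserving (fun y : Y ↦ γ • y) (riemannianVolume n Y) (riemannianVolume n Y) := by
  rw [riemannianVolume_eq_hausdorffMeasure hd]
  exact ((IsometryEquiv.constSMul (X := Y) γ).measurePreserving_hausdorffMeasure n).smul_measure
    (euclideanHausdorffRatio n)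

lemma isLinearisable_lp_riemannianVolume (hd : IsRiemannianOnComponents n Y) (Γ : Type*)
    [Group Γ] [MulAction Γ Y] [IsIsometricSMul Γ Y] (p : ℝ≥0∞) [Fact (1 ≤ p)] (hp : p ≠ ⊤) :
    IsLinearisable Γ Y (Lp ℝ p (riemannianVolume n Y)) := by
  obtain ⟨c, C, hc, hC, h⟩ := exists_lpKuratowskiEmbedding_bilipschitz hd
  obtain ⟨hmem, hbilip⟩ := h p hp
  refine ⟨lpRepresentation (riemannianVolume n Y) (measurePreserving_smul_riemannianVolume hd) p,
    lpKuratowskiEmbedding p (riemannianVolume n Y) hmem,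
    lpKuratowskiEmbedding_smul _ _ p hmem, C.toNNReal, c⁻¹.toNNReal,
    LipschitzWith.of_dist_le_mul fun x y ↦ ?_, AntilipschitzWith.of_le_mul_dist fun x y ↦ ?_⟩
  · rw [Real.coe_toNNReal _ hC.le]
    exact (hbilip x y).2
  · rw [Real.coe_toNNReal _ (inv_pos.2 hc).le, ← div_eq_inv_mul, le_div_iff₀ hc, mul_comm]
    exact (hbilip x y).1

end RiemannianKuratowski

end

theorem mainTheorem12 {n : ℕ} {Y : Type*} [MetricSpace Y] [CompactSpace Y]
    [MeasurableSpace Y] [BorelSpace Y]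
    [ChartedSpace (EuclideanSpace ℝ (Fin n)) Y] [IsManifold (𝓡 n) ∞ Y]
    [RiemannianBundle (fun y : Y ↦ TangentSpace (𝓡 n) y)]
    [IsContMDiffRiemannianBundle (𝓡 n) ∞ (EuclideanSpace ℝ (Fin n))
      (fun y : Y ↦ TangentSpace (𝓡 n) y)]
    (hd : IsRiemannianOnComponents n Y) :
    -- the metric induced by the Kuratowski embedding into `L^p` is Lipschitz equivalent to `d`,
    -- with constants independent of `p`
    (∃ c C : ℝ, 0 < c ∧ 0 < C ∧ ∀ (p : ENNReal) [Fact (1 ≤ p)], p ≠ ⊤ →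
      ∃ h : ∀ x : Y, MemLp (fun z ↦ dist x z) p (riemannianVolume n Y),
        ∀ x y : Y,
          c * dist x y ≤ dist (lpKuratowskiEmbedding p (riemannianVolume n Y) h x)
            (lpKuratowskiEmbedding p (riemannianVolume n Y) h y) ∧
          dist (lpKuratowskiEmbedding p (riemannianVolume n Y) h x)
            (lpKuratowskiEmbedding p (riemannianVolume n Y) h y) ≤ C * dist x y) ∧
    -- isometric actions are linearisable
    (∀ (Γ : Type*) [Group Γ] [MulAction Γ Y] [IsIsometricSMul Γ Y]
      (p : ENNReal) [Fact (1 ≤ p)], p ≠ ⊤ →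
        IsLinearisable Γ Y (Lp ℝ p (riemannianVolume n Y))) ∧
    -- in particular, if `Y` is a Lie group with a left-invariant distance, then the action of any
    -- subgroup by left translations is linearisable
    (∀ [Group Y] [LieGroup (𝓡 n) ∞ Y] [IsIsometricSMul Y Y] (Γ : Subgroup Y)
      (p : ENNReal) [Fact (1 ≤ p)], p ≠ ⊤ →
        IsLinearisable Γ Y (Lp ℝ p (riemannianVolume n Y))) := by
  refine ⟨exists_lpKuratowskiEmbedding_bilipschitz hd, ?_, ?_⟩
  · intro Γ _ _ _ p _ hp
    exact isLinearisable_lp_riemannianVolume hd Γ p hp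
  · intro _ _ _ Γ p _ hp
    have : IsIsometricSMul Γ Y := ⟨fun γ ↦ isometry_smul Y (γ : Y)⟩
    exact isLinearisable_lp_riemannianVolume hd Γ p hp
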